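/- **Theorem 3 (Joint convergence to multi time Brownian fields).** *Setting.* A point $(x,v,r)\in\mathbb R^3$ represents the space-time line $\ell(x,v)=\{(x+vt,t):t\in\mathbb R\}$ with mark $r$. A space-time point $(x',t')$ is to the right of the line if $x'\ge x+vt'$ and to its left otherwise. For $a,b\in\mathbb R^2$ let $ab$ be the set of $(x,v,r)$ such that $\ell(x,v)$ meets the segment $\overline{ab}$, let $ab_+$ be the set of those having $a$ on the left and $b$ on the right, and $ab_-$ the set of those having $a$ on the right and $b$ on the left. For a measure $\nu$ on $\mathbb R^3$ put $d\nu_2(x,v,r)=r^2\,d\nu(x,v,r)$ and, with $o$ the origin, $H_\nu(b)=\int r\,(\mathbf 1_{ob_+}-\mathbf 1_{ob_-})\,d\nu$. Let $d\mu(x,v,r)=\rho(x)\,dx\,d\mu(v,r|x)$, where $\rho\ge 0$ is locally integrable and $\mu(\cdot|x)$ are probability measures on $\mathbb R^2$, depending measurably on $x$, and assume that $\mu(ab)+\mu_2(ab)<\infty$ for all $a,b$. Assume that at every time $s'$ the image of $\mu$ under $(x,v,r)\mapsto(x+vs',v,r)$ has again a disintegration $dx\,\lambda_{x,s'}(dv,dr)$,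 where $\lambda_{\cdot,s'}$ is an s-finite kernel; one writes $\lambda_{x,s'}(dv,dr)=\rho(x-vs')\,d\mu(v,r|x-vs')$. Fix a macroscopic point $(z,s)$ such that the versions $\lambda$ are regular at $(z,s)$: the measure $(1+|v|)r^2\lambda_{z,s}(dv,dr)$ is finite, and $(z',s')\mapsto(1+|v|)r^2\lambda_{z',s'}(dv,dr)$ is continuous at $(z,s)$ for weak convergence (against bounded continuous functions). Put $$d\hat\mu_{z,s}(x,v,r)=dx\,\lambda_{z,s}(dv,dr)=\rho(z-vs)\,dx\,d\mu(v,r|z-vs),$$ $$d\tilde\mu_{z,s}(x,v,r)=dx\,\lambda_{z+x,s}(dv,dr)=\rho(z+x-vs)\,dx\,d\mu(v,r|z+x-vs),$$ and $d\hat\mu_{2,z,s}=r^2\,d\hat\mu_{z,s}$, $d\tilde\mu_{2,z,s}=r^2\,d\tilde\mu_{z,s}$. For $\varepsilon>0$ let $X^\varepsilon$ be a Poisson process on $\mathbb R^3$ with intensity measure $\varepsilon^{-1}\mu$, let $N^\varepsilon=\varepsilon\sum_{p\in X^\varepsilon}\delta_p$, and define $$H^{\varepsilon}_{z,s}(b)=H_{N^\varepsilon}(b+(z,s))-H_{N^\varepsilon}(z,s),\qquad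 H_{z,s}(b)=H_\mu(b+(z,s))-H_\mu(z,s),$$ $$\hat\eta^\varepsilon_{z,s}(b)=\varepsilon^{-1/2}\varepsilon^{-1}\bigl(H^{\varepsilon^2}_{z,s}(\varepsilon b)-H_{z,s}(\varepsilon b)\bigr),\qquad \tilde\eta^\varepsilon_{z,s}(b)=\varepsilon^{-1}\bigl(H^{\varepsilon^2}_{z,s}(b)-H_{z,s}(b)\bigr).$$ The Lévy–Chentsov field with distance $d$ is the centered Gaussian field $\eta$ on $\mathbb R^2$ with covariances $\mathrm{Cov}(\eta(a),\eta(b))=\tfrac12\bigl(d(o,a)+d(o,b)-d(a,b)\bigr)$. *Statement.* There are independent fields $\hat\eta_{z,s}$ and $\tilde\eta_{z,s}$, defined on a common probability space, which are Lévy–Chentsov fields with distances $\hat d(a,b)=\hat\mu_{2,z,s}(ab)$ and $\tilde d(a,b)=\tilde\mu_{2,z,s}(ab)$ respectively, such that, as $\varepsilon\to0$, $$(\hat\eta^\varepsilon_{z,s},\tilde\eta^\varepsilon_{z,s})\longrightarrow(\hat\eta_{z,s},\tilde\eta_{z,s})$$ jointly in law, in the sense of finite-dimensional distributions: for all finite sets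 $I,J\subset\mathbb R^2$ the random vector $\bigl((\hat\eta^\varepsilon_{z,s}(a))_{a\in I},(\tilde\eta^\varepsilon_{z,s}(b))_{b\in J}\bigr)$ converges in distribution to $\bigl((\hat\eta_{z,s}(a))_{a\in I},(\tilde\eta_{z,s}(b))_{b\in J}\bigr)$. -/

import Mathlib

open MeasureTheory ProbabilityTheory Filter Topology
open scoped ENNReal NNReal

noncomputable section

namespace Multitime

/-- The space-time plane: `(x, t)` is the point at position `x` and time `t`. -/
abbrev Plane : Type := ℝ × ℝ

/-- The space-velocity-mark space: `(x, v, r)` codifies a line with mark `r`. -/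
abbrev Marked : Type := ℝ × ℝ × ℝ

/-! ### Lines, half-planes and crossing sets -/

/-- The space-time line `{(x + v t, t) : t ∈ ℝ}` of the point `(x, v, r)`. -/
def line (p : Marked) : Set Plane := Set.range fun t : ℝ => (p.1 + p.2.1 * t, t)

/-- The right half-plane of the line, containing the line. -/
def rightHalf (p : Marked) : Set Plane := {c | p.1 + c.2 * p.2.1 ≤ c.1}

/-- The left half-plane of the line. -/
def leftHalf (p : Marked) : Set Plane := {c | c.1 < p.1 + c.2 * p.2.1}

/-- `ab`: the points whose line intersects the segment with extremes `a` and `b`. -/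
def cross (a b : Plane) : Set Marked := {p | (line p ∩ segment ℝ a b).Nonempty}

/-- `ab₊`: the points whose line has `a` on its left and `b` on its right. -/
def crossPos (a b : Plane) : Set Marked := {p | a ∈ leftHalf p ∧ b ∈ rightHalf p}

/-- `ab₋`: the points whose line has `a` on its right and `b` on its left. -/
def crossNeg (a b : Plane) : Set Marked := {p | a ∈ rightHalf p ∧ b ∈ leftHalf p}

/-! ### Measures on the space-velocity-mark space and the surfaces they generate -/

/-- `dμ₂(x, v, r) = r² dμ(x, v, r)`. -/
def secondMoment (μ : Measure Marked) : Measure Marked :=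
  μ.withDensity fun p => ENNReal.ofReal (p.2.2 ^ 2)

/-- The class of measures with `μ(ab) + μ₂(ab) < ∞` for all `a`, `b`. -/
def InM (μ : Measure Marked) : Prop :=
  ∀ a b : Plane, μ (cross a b) + secondMoment μ (cross a b) < ∞

/-- The elementary surface `r (1{ob₊} - 1{ob₋})` generated by the marked line `(x, v, r)`. -/
def step (b : Plane) (p : Marked) : ℝ :=
  p.2.2 * ((crossPos 0 b).indicator 1 p - (crossNeg 0 b).indicator 1 p)

/-- The surface `H_μ(b) = ∫ h_{x,v,r}(b) dμ(x, v, r)`; for an empirical measure it is the sum of the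
elementary surfaces of the points of the configuration. -/
def height (μ : Measure Marked) (b : Plane) : ℝ := ∫ p, step b p ∂μ

/-- The height of the surface at `(z, s) + b`, relative to the height at `(z, s)`. -/
def relHeight (μ : Measure Marked) (z s : ℝ) (b : Plane) : ℝ :=
  height μ (b + (z, s)) - height μ (z, s)

/-! ### Poisson processes and fluctuation fields -/

/-- The empirical (counting) measure of a configuration: `A ↦ |X ∩ A|`. -/
def empirical (X : Set Marked) : Measure Marked :=
  Measure.sum fun p : X => Measure.dirac (p : Marked)

/-- `X` is a Poisson process with intensity measure `μ`. -/
structure IsPoissonProcess {Ω : Type*} [MeasurableSpace Ω] (P : Measure Ω)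
    (X : Ω → Set Marked) (μ : Measure Marked) : Prop where
  measurable : ∀ A : Set Marked, MeasurableSet A → Measurable fun ω => empirical (X ω) A
  law : ∀ A : Set Marked, MeasurableSet A → μ A < ∞ →
    P.map (fun ω => empirical (X ω) A) =
      (poissonMeasure (μ A).toNNReal).map (Nat.cast : ℕ → ℝ≥0∞)
  indep : ∀ (n : ℕ) (A : Fin n → Set Marked), (∀ i, MeasurableSet (A i)) →
    Pairwise (fun i j => Disjoint (A i) (A j)) →
    iIndepFun (fun i ω => empirical (X ω) (A i)) P

/-- The rescaled empirical measure `N^ε = ε ∑_{p ∈ X} δ_p`. -/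
def scaledEmpirical (ε : ℝ) (X : Set Marked) : Measure Marked :=
  ENNReal.ofReal ε • empirical X

/-- The microscopic fluctuation field
`ε^{-1/2} ε^{-1} (H^{ε²}_{z,s}(ε b) - H_{z,s}(ε b))`; `X` is the configuration `X^{ε²}`. -/
def microField (μ : Measure Marked) (z s ε : ℝ) (X : Set Marked) (b : Plane) : ℝ :=
  ε ^ (-(1 / 2) : ℝ) * ε⁻¹ *
    (relHeight (scaledEmpirical (ε ^ 2) X) z s (ε • b) - relHeight μ z s (ε • b))

/-- The macroscopic fluctuation field
`ε^{-1} (H^{ε²}_{z,s}(b) - H_{z,s}(b))`; `X` is the configuration `X^{ε²}`. -/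
def macroField (μ : Measure Marked) (z s ε : ℝ) (X : Set Marked) (b : Plane) : ℝ :=
  ε⁻¹ * (relHeight (scaledEmpirical (ε ^ 2) X) z s b - relHeight μ z s b)

/-! ### Disintegration in the space coordinate -/

/-- The measure `ρ(x) dx dμ(v, r | x)`. -/
def ofDensity (ρ : ℝ → ℝ) (κ : Kernel ℝ (ℝ × ℝ)) : Measure Marked :=
  (volume.withDensity fun x => ENNReal.ofReal (ρ x)) ⊗ₘ κ

/-- The image of `μ` when every point `(x, v, r)` moves ballistically during a time `s`. -/
def flow (μ : Measure Marked) (s : ℝ) : Measure Marked :=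
  μ.map fun p => (p.1 + p.2.1 * s, p.2)

/-- `Λ s x` is a version of the velocity-mark measure `ρ(x - v s) dμ(v, r | x - v s)` seen at the
space-time point `(x, s)`, where `dμ = ρ(x) dx dμ(v, r | x)`. That is, for every time `s` and every
measurable `φ ≥ 0`,
`∫ φ(x + v s, v, r) dμ(x, v, r) = ∫ (∫ φ(x, v, r) Λ s x (dv, dr)) dx`. -/
structure IsLocalDensity (μ : Measure Marked) (Λ : ℝ → Kernel ℝ (ℝ × ℝ)) : Prop where
  sFinite : ∀ s, IsSFiniteKernel (Λ s)
  disintegration : ∀ s, flow μ s = (volume : Measure ℝ) ⊗ₘ Λ s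

/-- The local velocity-mark measure, weighted by `(1 + |v|) r²`, is finite at `(z, s)` and weakly
continuous there as a function of the space-time point. -/
structure RegularAt (Λ : ℝ → Kernel ℝ (ℝ × ℝ)) (z s : ℝ) : Prop where
  finite : ∫⁻ q, ENNReal.ofReal ((1 + |q.1|) * q.2 ^ 2) ∂(Λ s z) < ∞
  continuous : ∀ φ : BoundedContinuousFunction (ℝ × ℝ) ℝ≥0,
    Tendsto
      (fun c : Plane => ∫⁻ q, (φ q : ℝ≥0∞) * ENNReal.ofReal ((1 + |q.1|) * q.2 ^ 2) ∂(Λ c.2 c.1))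
      (𝓝 (z, s))
      (𝓝 (∫⁻ q, (φ q : ℝ≥0∞) * ENNReal.ofReal ((1 + |q.1|) * q.2 ^ 2) ∂(Λ s z)))

/-- `dx ρ(z - v s) dμ(v, r | z - v s)`: the measure frozen at the space-time point `(z, s)`. -/
def hatMeasure (Λ : ℝ → Kernel ℝ (ℝ × ℝ)) (z s : ℝ) : Measure Marked :=
  (volume : Measure ℝ).prod (Λ s z)

/-- `dx ρ(z + x - v s) dμ(v, r | z + x - v s)`: the measure seen from `(z, s)`. -/
def tildeMeasure (Λ : ℝ → Kernel ℝ (ℝ × ℝ)) (z s : ℝ) : Measure Marked :=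
  (volume : Measure ℝ) ⊗ₘ (Λ s).comap (fun x => z + x) (measurable_const_add z)

/-! ### Lévy–Chentsov fields -/

/-- The distance `(a, b) ↦ μ₂(ab)`. -/
def crossDist (μ : Measure Marked) (a b : Plane) : ℝ := (secondMoment μ (cross a b)).toReal

/-- `η` is a Lévy–Chentsov field with distance `d`: a centered Gaussian field with covariances
`(d(o, a) + d(o, b) - d(a, b)) / 2`. -/
structure IsLevyChentsov {Ω : Type*} [MeasurableSpace Ω] (P : Measure Ω)
    (η : Plane → Ω → ℝ) (d : Plane → Plane → ℝ) : Prop where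
  gaussian : IsGaussianProcess η P
  centered : ∀ a, ∫ ω, η a ω ∂P = 0
  covariance : ∀ a b, cov[η a, η b; P] = (d 0 a + d 0 b - d a b) / 2

/-! ### The scaling parameter -/

/-- Positive scaling parameters. -/
abbrev Scale : Type := Set.Ioi (0 : ℝ)

/-- The scale `ε²`. -/
def Scale.sq (ε : Scale) : Scale := ⟨(ε : ℝ) ^ 2, Set.mem_Ioi.2 (pow_pos (Set.mem_Ioi.1 ε.2) 2)⟩

/-- The filter `ε → 0`, `ε > 0`. -/
def Scale.toZero : Filter Scale := comap Subtype.val (𝓝 (0 : ℝ))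

end Multitime

end

namespace Multitime

/-! ### The position of a point relative to a line -/

/-! Every finite linear combination of values of the two fields is an integral of one function
against a compensated Poisson process of intensity `ε⁻² μ`. That function, `integrand`, is `ε` times
a weighted sum of elementary surfaces `jump`. Its characteristic function is therefore `exp ∫
(e^{if} - 1 - if) dν` (`IsPoissonProcess.charFun_compensated`). A Taylor bound replaces the exponent
by `-½ ∫ f² dν` under a Lindeberg condition (`tendsto_compensated_exponent`), so convergence of a
Gram matrix in `L²(μ)` is what remains (`RegularAt.tendsto_gram`).

By polarization the integral of a product of two jumps is a combination of `μ₂`-masses of sets of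
separating lines, which is the Lévy–Chentsov form of the covariance. The macroscopic block does not
depend on `ε`: the measure seen from `(z, s)` is the image of `μ` under a motion of the lines
(`IsLocalDensity.tildeMeasure_eq`). In the mixed block the product of jumps is dominated by the
square of the microscopic one, whose integral is of order `ε`. The weight `ε^{-1/2}` leaves `O(√ε)`,
and this gives independence in the limit.

The microscopic block needs `μ₂` of the lines crossing a segment of length of order `ε` near `(z,
s)` (`RegularAt.tendsto_flux`). The local densities describe directly only the flux through
horizontal segments, at a fixed time. A slanted segment is treated by averaging over horizontal
translations of length at most `h = εδ`. For each line, Tonelli turns the average into an average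
over the points of the segment of horizontal fluxes weighted by the drift of the line relative to
the segment (`lintegral_flux_shift`). Weak continuity makes these close to their value at `(z, s)`.
Undoing the translation costs only horizontal fluxes of length at most `h` at the two endpoints,
which is `O(δ)` relative to `ε`, with `δ` arbitrary.

The limit fields are images of the jump functions under a Gaussian isometry of `L²(hat) ⊕
L²(tilde)`. Orthogonality of the summands becomes independence. -/

/-- The signed horizontal distance from the line `p` to the point `a`. -/
def offset (a : Plane) (p : Marked) : ℝ := a.1 - (p.1 + a.2 * p.2.1)

/-- The marked lines passing through `a`. -/
def onLine (a : Plane) : Set Marked := {p | offset a p = 0}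

/-- The marked lines separating `a` from `b`. -/
def sep (a b : Plane) : Set Marked := crossPos a b ∪ crossNeg a b

open Classical in
/-- The indicator that `a` is to the right of the line. -/
noncomputable def side (a : Plane) (p : Marked) : ℝ := if 0 ≤ offset a p then 1 else 0

/-- The height difference between `a` and `c` generated by a marked line. -/
noncomputable def jump (c a : Plane) (p : Marked) : ℝ := p.2.2 * (side a p - side c p)

lemma mem_rightHalf_iff {a : Plane} {p : Marked} : a ∈ rightHalf p ↔ 0 ≤ offset a p := by
  simp [rightHalf, offset]

lemma mem_leftHalf_iff {a : Plane} {p : Marked} : a ∈ leftHalf p ↔ offset a p < 0 := by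
  simp [leftHalf, offset]

@[fun_prop]
lemma measurable_offset (a : Plane) : Measurable (offset a) := by
  unfold offset; fun_prop

@[fun_prop]
lemma measurable_side (a : Plane) : Measurable (side a) := by
  unfold side
  exact Measurable.ite (measurableSet_le measurable_const (measurable_offset a))
    measurable_const measurable_const

@[fun_prop]
lemma measurable_jump (c a : Plane) : Measurable (jump c a) := by
  unfold jump; fun_prop

lemma measurableSet_onLine (a : Plane) : MeasurableSet (onLine a) :=
  measurableSet_eq_fun (measurable_offset a) measurable_const

lemma mem_crossPos_iff {a b : Plane} {p : Marked} :
    p ∈ crossPos a b ↔ offset a p < 0 ∧ 0 ≤ offset b p := by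
  simp [crossPos, mem_leftHalf_iff, mem_rightHalf_iff]

lemma mem_crossNeg_iff {a b : Plane} {p : Marked} :
    p ∈ crossNeg a b ↔ 0 ≤ offset a p ∧ offset b p < 0 := by
  simp [crossNeg, mem_leftHalf_iff, mem_rightHalf_iff]

lemma mem_sep_iff {a b : Plane} {p : Marked} :
    p ∈ sep a b ↔ (offset a p < 0 ∧ 0 ≤ offset b p) ∨ (0 ≤ offset a p ∧ offset b p < 0) := by
  simp [sep, mem_crossPos_iff, mem_crossNeg_iff]

lemma measurableSet_sep (a b : Plane) : MeasurableSet (sep a b) := by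
  have : sep a b = ({p | offset a p < 0} ∩ {p | 0 ≤ offset b p}) ∪
      ({p | 0 ≤ offset a p} ∩ {p | offset b p < 0}) := by
    ext p; simp [mem_sep_iff]
  rw [this]
  have h1 := measurable_offset a
  have h2 := measurable_offset b
  exact ((measurableSet_lt h1 measurable_const).inter (measurableSet_le measurable_const h2)).union
    ((measurableSet_le measurable_const h1).inter (measurableSet_lt h2 measurable_const))

lemma sep_comm (a b : Plane) : sep a b = sep b a := by
  ext p; simp only [mem_sep_iff]; tauto

lemma sep_subset_union (a b c : Plane) : sep a b ⊆ sep a c ∪ sep c b := by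
  intro p
  simp only [Set.mem_union, mem_sep_iff]
  rcases lt_or_ge (offset c p) 0 with h | h <;> grind

/-- The signed indicators of the two crossing sets are the difference of two right-side indicators.
This form telescopes, so height differences are again jumps based at another point. -/
lemma step_eq_jump (b : Plane) : step b = jump 0 b := by
  ext p
  simp only [step, jump, side, Set.indicator, mem_crossPos_iff, mem_crossNeg_iff, Pi.one_apply]
  split_ifs <;> first | (exfalso; grind) | ring1

lemma jump_sub_jump (a b c : Plane) (p : Marked) : jump c a p - jump c b p = jump b a p := by
  simp only [jump]; ring

lemma jump_sq (c a : Plane) (p : Marked) :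
    jump c a p ^ 2 = (sep c a).indicator (fun p => p.2.2 ^ 2) p := by
  simp only [jump, side, Set.indicator, mem_sep_iff]
  split_ifs <;> first | (exfalso; grind) | ring1

lemma abs_jump (c a : Plane) (p : Marked) :
    |jump c a p| = (sep c a).indicator (fun p => |p.2.2|) p := by
  simp only [jump, side, Set.indicator, mem_sep_iff]
  split_ifs <;> first | (exfalso; grind) | simp

/-- Polarization: the difference of two jumps with a common base is the jump between their ends.
This is where the covariance `(d(o,a) + d(o,b) - d(a,b)) / 2` comes from. -/
lemma jump_mul_jump (c a b : Plane) (p : Marked) :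
    jump c a p * jump c b p = (jump c a p ^ 2 + jump c b p ^ 2 - jump a b p ^ 2) / 2 := by
  rw [← jump_sub_jump b a c]; ring

/-! ### Lines meeting a segment -/

/-- The offset is affine along the segment and vanishes exactly on the line, so the line is met
exactly when the values at the endpoints do not have the same strict sign. -/
lemma mem_cross_iff {a b : Plane} {p : Marked} : p ∈ cross a b ↔ offset a p * offset b p ≤ 0 := by
  constructor
  · rintro ⟨c, ⟨t, rfl⟩, ⟨u, v, hu, hv, huv, h⟩⟩
    have h1 := congrArg Prod.fst h
    have h2 := congrArg Prod.snd h
    simp only [Prod.fst_add, Prod.snd_add, Prod.smul_fst, Prod.smul_snd, smul_eq_mul] at h1 h2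
    have key : u * offset a p + v * offset b p = 0 := by
      simp only [offset]
      linear_combination h1 - p.2.1 * h2 - p.1 * huv
    by_contra! hlt
    rcases lt_or_ge (offset a p) 0 with ha | ha
    · have hb : offset b p < 0 := by nlinarith
      rcases hu.eq_or_lt with rfl | hu'
      · nlinarith
      · nlinarith
    · have ha' : 0 < offset a p := lt_of_le_of_ne ha (by rintro h0; rw [← h0] at hlt; simp at hlt)
      have hb : 0 < offset b p := by
        by_contra! hb; nlinarith
      rcases hu.eq_or_lt with rfl | hu'
      · nlinarith
      · nlinarith
  · intro h
    obtain ⟨u, v, hu, hv, huv, key⟩ : ∃ u v : ℝ, 0 ≤ u ∧ 0 ≤ v ∧ u + v = 1 ∧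
        u * offset a p + v * offset b p = 0 := by
      by_cases h0 : offset a p = 0
      · exact ⟨1, 0, by simp, le_rfl, by simp, by simp [h0]⟩
      have hne : |offset a p| + |offset b p| ≠ 0 := by positivity
      -- The zero of the affine interpolation divides the segment in the ratio of the absolute
      -- offsets.
      refine ⟨|offset b p| / (|offset a p| + |offset b p|),
        |offset a p| / (|offset a p| + |offset b p|), by positivity, by positivity, ?_, ?_⟩
      · field_simp; ring
      · field_simp
        rcases lt_or_gt_of_ne h0 with ha | ha
        · have hb : 0 ≤ offset b p := by by_contra! hb; nlinarith
          rw [abs_of_neg ha, abs_of_nonneg hb]; ring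
        · have hb : offset b p ≤ 0 := by by_contra! hb; nlinarith
          rw [abs_of_pos ha, abs_of_nonpos hb]; ring
    refine ⟨u • a + v • b, ⟨u * a.2 + v * b.2, ?_⟩, ⟨u, v, hu, hv, huv, rfl⟩⟩
    simp only [offset] at key
    ext
    · simp
      linear_combination -key - p.1 * huv
    · simp

lemma measurableSet_cross (a b : Plane) : MeasurableSet (cross a b) := by
  have : cross a b = {p | offset a p * offset b p ≤ 0} := by ext p; exact mem_cross_iff
  rw [this]
  exact measurableSet_le (by fun_prop) measurable_const

lemma sep_subset_cross (a b : Plane) : sep a b ⊆ cross a b := by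
  intro p hp
  rw [mem_cross_iff]
  rcases mem_sep_iff.1 hp with ⟨h1, h2⟩ | ⟨h1, h2⟩ <;> nlinarith

lemma cross_subset (a b : Plane) : cross a b ⊆ sep a b ∪ (onLine a ∪ onLine b) := by
  intro p hp
  rw [mem_cross_iff] at hp
  by_cases ha : offset a p = 0
  · exact Or.inr (Or.inl ha)
  by_cases hb : offset b p = 0
  · exact Or.inr (Or.inr hb)
  left
  rw [mem_sep_iff]
  rcases lt_or_gt_of_ne ha with ha | ha
  · left; exact ⟨ha, by by_contra! h; nlinarith⟩
  · right; exact ⟨ha.le, lt_of_le_of_ne (by by_contra! h; nlinarith) hb⟩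

/-! ### Covariances of the elementary surfaces -/

/-- Measures that do not charge the lines through a given point and give a finite second moment to
the crossing sets. -/
structure IsCrossRegular (ν : Measure Marked) : Prop where
  null : ∀ a, ν (onLine a) = 0
  finite : ∀ a b, secondMoment ν (cross a b) < ∞

lemma secondMoment_apply (ν : Measure Marked) {A : Set Marked} (hA : MeasurableSet A) :
    secondMoment ν A = ∫⁻ p in A, ENNReal.ofReal (p.2.2 ^ 2) ∂ν := by
  rw [secondMoment, withDensity_apply _ hA]

/-- Meeting the segment and separating its endpoints differ only on lines through an endpoint, which
form a null set. Distances can then be computed with `sep`, which is what the jumps see. -/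
lemma IsCrossRegular.secondMoment_cross {ν : Measure Marked} (hν : IsCrossRegular ν)
    (a b : Plane) : secondMoment ν (cross a b) = secondMoment ν (sep a b) := by
  refine le_antisymm ?_ (measure_mono (sep_subset_cross a b))
  have hac : ∀ c, secondMoment ν (onLine c) = 0 := fun c =>
    withDensity_absolutelyContinuous ν _ (hν.null c)
  calc secondMoment ν (cross a b)
      ≤ secondMoment ν (sep a b ∪ (onLine a ∪ onLine b)) := measure_mono (cross_subset a b)
    _ ≤ secondMoment ν (sep a b) + (secondMoment ν (onLine a) + secondMoment ν (onLine b)) :=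
        (measure_union_le _ _).trans (by gcongr; exact measure_union_le _ _)
    _ = secondMoment ν (sep a b) := by simp [hac]

lemma lintegral_jump_sq (ν : Measure Marked) (a b : Plane) :
    ∫⁻ p, ENNReal.ofReal (jump a b p ^ 2) ∂ν = secondMoment ν (sep a b) := by
  rw [secondMoment_apply ν (measurableSet_sep a b), ← lintegral_indicator (measurableSet_sep a b)]
  congr with p
  rw [jump_sq]
  by_cases h : p ∈ sep a b <;> simp [h]

lemma IsCrossRegular.integrable_jump_sq {ν : Measure Marked} (hν : IsCrossRegular ν)
    (a b : Plane) : Integrable (fun p => jump a b p ^ 2) ν := by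
  refine ⟨by fun_prop, ?_⟩
  rw [hasFiniteIntegral_iff_ofReal (ae_of_all _ fun p => sq_nonneg _), lintegral_jump_sq,
    ← hν.secondMoment_cross]
  exact hν.finite a b

lemma IsCrossRegular.memLp_jump {ν : Measure Marked} (hν : IsCrossRegular ν)
    (a b : Plane) : MemLp (jump a b) 2 ν :=
  (memLp_two_iff_integrable_sq (by fun_prop)).2 (hν.integrable_jump_sq a b)

lemma IsCrossRegular.integral_jump_sq {ν : Measure Marked} (hν : IsCrossRegular ν)
    (a b : Plane) : ∫ p, jump a b p ^ 2 ∂ν = crossDist ν a b := by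
  rw [integral_eq_lintegral_of_nonneg_ae (ae_of_all _ fun p => sq_nonneg _) (by fun_prop),
    lintegral_jump_sq, crossDist, hν.secondMoment_cross]

lemma IsCrossRegular.integrable_jump_mul_jump {ν : Measure Marked} (hν : IsCrossRegular ν)
    (c a d b : Plane) : Integrable (fun p => jump c a p * jump d b p) ν :=
  (hν.memLp_jump c a).integrable_mul (hν.memLp_jump d b)

lemma IsCrossRegular.integral_jump_mul_jump {ν : Measure Marked} (hν : IsCrossRegular ν)
    (c a b : Plane) : ∫ p, jump c a p * jump c b p ∂ν =
      (crossDist ν c a + crossDist ν c b - crossDist ν a b) / 2 := by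
  simp_rw [jump_mul_jump]
  rw [integral_div, integral_sub, integral_add, hν.integral_jump_sq, hν.integral_jump_sq,
    hν.integral_jump_sq]
  · exact hν.integrable_jump_sq c a
  · exact hν.integrable_jump_sq c b
  · exact (hν.integrable_jump_sq c a).add (hν.integrable_jump_sq c b)
  · exact hν.integrable_jump_sq a b

/-! ### The local densities -/

section LocalDensity

variable {μ : Measure Marked} {Λ : ℝ → Kernel ℝ (ℝ × ℝ)}

@[fun_prop]
lemma measurable_flowMap (s : ℝ) :
    Measurable (fun p : Marked => ((p.1 + p.2.1 * s, p.2) : Marked)) := by fun_prop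

lemma IsLocalDensity.lintegral_flow (hΛ : IsLocalDensity μ Λ) (s : ℝ) {f : Marked → ℝ≥0∞}
    (hf : Measurable f) :
    ∫⁻ p, f (p.1 + p.2.1 * s, p.2) ∂μ = ∫⁻ y, ∫⁻ q, f (y, q) ∂(Λ s y) := by
  have := hΛ.sFinite s
  rw [← Measure.lintegral_compProd hf, ← hΛ.disintegration s, flow,
    lintegral_map hf (measurable_flowMap s)]

lemma compProd_onLine_eq_zero {κ : Kernel ℝ (ℝ × ℝ)} [IsSFiniteKernel κ] (x : ℝ) :
    ((volume : Measure ℝ) ⊗ₘ κ) {p | p.1 = x} = 0 := by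
  have hs : MeasurableSet {p : Marked | p.1 = x} :=
    measurableSet_eq_fun measurable_fst measurable_const
  rw [Measure.compProd_apply hs, lintegral_eq_zero_iff (Kernel.measurable_kernel_prodMk_left hs)]
  have : ∀ᵐ y : ℝ, y ≠ x := by simp [ae_iff]
  filter_upwards [this] with y hy
  simp [hy]

/-- At the time of `a`, the lines through `a` all sit at a single position, and the flowed measure
disintegrates over Lebesgue measure in position. -/
lemma IsLocalDensity.onLine_null (hΛ : IsLocalDensity μ Λ) (a : Plane) : μ (onLine a) = 0 := by
  have := hΛ.sFinite a.2
  have h := compProd_onLine_eq_zero (κ := Λ a.2) a.1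
  rw [← hΛ.disintegration, flow, Measure.map_apply (measurable_flowMap _)
    (measurableSet_eq_fun measurable_fst measurable_const)] at h
  convert h using 2
  ext p
  simp only [onLine, offset, Set.mem_ofPred_eq, Set.mem_preimage]
  constructor <;> intro h <;> linarith

lemma IsLocalDensity.isCrossRegular (hΛ : IsLocalDensity μ Λ) (hM : InM μ) :
    IsCrossRegular μ where
  null := hΛ.onLine_null
  finite a b := lt_of_le_of_lt le_add_self (hM a b)

/-- The motion of the marked lines that moves `(z, s)` to the origin. -/
def recenter (z s : ℝ) (p : Marked) : Marked := (p.1 + p.2.1 * s - z, p.2)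

@[fun_prop]
lemma measurable_recenter (z s : ℝ) : Measurable (recenter z s) := by
  unfold recenter; fun_prop

lemma offset_recenter (z s : ℝ) (a : Plane) (p : Marked) :
    offset a (recenter z s p) = offset (a + (z, s)) p := by
  simp only [offset, recenter, Prod.fst_add, Prod.snd_add]; ring

/-- Flowing for time `s` and translating by `-z` is a change of variables for `μ`. Hence macroscopic
covariances are exact and require no limit. -/
lemma IsLocalDensity.tildeMeasure_eq (hΛ : IsLocalDensity μ Λ) (z s : ℝ) :
    tildeMeasure Λ z s = μ.map (recenter z s) := by
  have := hΛ.sFinite s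
  ext A hA
  have hg : Measurable fun p : Marked => A.indicator (1 : Marked → ℝ≥0∞) (p.1 - z, p.2) :=
    (measurable_one.indicator hA).comp (by fun_prop)
  rw [Measure.map_apply (by fun_prop) hA, tildeMeasure,
    ← lintegral_indicator_one hA, ← lintegral_indicator_one (measurable_recenter z s hA),
    Measure.lintegral_compProd (measurable_one.indicator hA)]
  have h1 := hΛ.lintegral_flow s hg
  have h2 : ∫⁻ y, ∫⁻ q, A.indicator (1 : Marked → ℝ≥0∞) (y - z, q) ∂(Λ s y) =
      ∫⁻ x, ∫⁻ q, A.indicator (1 : Marked → ℝ≥0∞) (x, q) ∂(Λ s (z + x)) := by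
    rw [← lintegral_add_left_eq_self _ z]
    simp
  simp only [Kernel.comap_apply]
  rw [← h2, ← h1]
  rfl

lemma mem_cross_recenter {z s : ℝ} {a b : Plane} {p : Marked} :
    recenter z s p ∈ cross a b ↔ p ∈ cross (a + (z, s)) (b + (z, s)) := by
  simp [mem_cross_iff, offset_recenter]

lemma IsLocalDensity.secondMoment_tildeMeasure (hΛ : IsLocalDensity μ Λ) (z s : ℝ)
    (a b : Plane) : secondMoment (tildeMeasure Λ z s) (cross a b) =
      secondMoment μ (cross (a + (z, s)) (b + (z, s))) := by
  rw [secondMoment_apply _ (measurableSet_cross _ _), secondMoment_apply _ (measurableSet_cross _ _),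
    hΛ.tildeMeasure_eq, setLIntegral_map (measurableSet_cross _ _) (by fun_prop) (by fun_prop)]
  congr 2
  ext p
  exact mem_cross_recenter

lemma IsLocalDensity.crossDist_tildeMeasure (hΛ : IsLocalDensity μ Λ) (z s : ℝ)
    (a b : Plane) : crossDist (tildeMeasure Λ z s) a b =
      crossDist μ (a + (z, s)) (b + (z, s)) := by
  rw [crossDist, crossDist, hΛ.secondMoment_tildeMeasure]

lemma IsLocalDensity.isCrossRegular_tildeMeasure (hΛ : IsLocalDensity μ Λ) (hM : InM μ)
    (z s : ℝ) : IsCrossRegular (tildeMeasure Λ z s) where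
  null a := by
    rw [hΛ.tildeMeasure_eq, Measure.map_apply (by fun_prop) (measurableSet_onLine a)]
    convert hΛ.onLine_null (a + (z, s)) using 2
    ext p
    simp [onLine, offset_recenter]
  finite a b := by
    rw [hΛ.secondMoment_tildeMeasure]
    exact (hΛ.isCrossRegular hM).finite _ _

/-! ### The measure frozen at a space-time point -/

/-- The relative horizontal displacement between the segment from `a` to `b` and a line of
velocity `v` during the time of the segment. -/
def drift (a b : Plane) (v : ℝ) : ℝ := b.1 - a.1 - v * (b.2 - a.2)

@[fun_prop]
lemma measurable_drift (a b : Plane) : Measurable (drift a b) := by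
  unfold drift; fun_prop

@[fun_prop]
lemma continuous_drift (a b : Plane) : Continuous (drift a b) := by
  unfold drift; fun_prop

/-- Lines of velocity `v` separate the points exactly when they start between the projections of `a`
and `b` to time zero along that velocity. The distance between these projections is the absolute
drift. -/
lemma volume_sep (a b : Plane) (q : ℝ × ℝ) :
    volume {x : ℝ | (x, q) ∈ sep a b} = ENNReal.ofReal |drift a b q.1| := by
  have : {x : ℝ | (x, q) ∈ sep a b} =
      Set.Ioc (a.1 - a.2 * q.1) (b.1 - b.2 * q.1) ∪
        Set.Ioc (b.1 - b.2 * q.1) (a.1 - a.2 * q.1) := by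
    ext x
    simp only [mem_sep_iff, offset, Set.mem_ofPred_eq, Set.mem_union, Set.mem_Ioc]
    constructor
    · rintro (⟨h1, h2⟩ | ⟨h1, h2⟩)
      · left; constructor <;> linarith
      · right; constructor <;> linarith
    · rintro (⟨h1, h2⟩ | ⟨h1, h2⟩)
      · left; constructor <;> linarith
      · right; constructor <;> linarith
  rw [this]
  rcases le_total (a.1 - a.2 * q.1) (b.1 - b.2 * q.1) with h | h
  · rw [Set.Ioc_eq_empty (not_lt.2 h), Set.union_empty, Real.volume_Ioc, abs_of_nonneg]
    · congr 1; simp only [drift]; ring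
    · simp only [drift]; linarith
  · rw [Set.Ioc_eq_empty (not_lt.2 h), Set.empty_union, Real.volume_Ioc, abs_of_nonpos]
    · congr 1; simp only [drift]; ring
    · simp only [drift]; linarith

/-- The lines of the frozen measure separating two points. -/
lemma setLIntegral_sep_prod (κ : Measure (ℝ × ℝ)) [SFinite κ] (a b : Plane)
    {f : ℝ × ℝ → ℝ≥0∞} (hf : Measurable f) :
    ∫⁻ p in sep a b, f p.2 ∂((volume : Measure ℝ).prod κ) =
      ∫⁻ q, f q * ENNReal.ofReal |drift a b q.1| ∂κ := by
  have hs := measurableSet_sep a b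
  rw [← lintegral_indicator hs, lintegral_prod_symm' _
    ((show Measurable fun p : Marked => f p.2 from hf.comp measurable_snd).indicator hs)]
  congr with q
  have : ∀ x : ℝ, (sep a b).indicator (fun p : Marked => f p.2) (x, q) =
      {x : ℝ | (x, q) ∈ sep a b}.indicator (fun _ => f q) x := fun x => rfl
  simp_rw [this]
  have hq : MeasurableSet {x : ℝ | (x, q) ∈ sep a b} := measurable_prodMk_right hs
  rw [lintegral_indicator_const hq, volume_sep]

/-- The linear growth in the velocity explains the weight `(1 + |v|) r²` in the regularity
assumption: crossing masses are integrals of `r²` times the absolute drift. -/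
lemma abs_drift_le (a b : Plane) (v : ℝ) :
    |drift a b v| ≤ (|b.1 - a.1| + |b.2 - a.2|) * (1 + |v|) := by
  unfold drift
  calc |b.1 - a.1 - v * (b.2 - a.2)| ≤ |b.1 - a.1| + |v * (b.2 - a.2)| := abs_sub _ _
    _ ≤ _ := by
      rw [abs_mul]
      nlinarith [abs_nonneg (b.1 - a.1), abs_nonneg (b.2 - a.2), abs_nonneg v]

lemma secondMoment_hat_sep {z s : ℝ} (hΛ : IsLocalDensity μ Λ) (a b : Plane) :
    secondMoment (hatMeasure Λ z s) (sep a b) =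
      ∫⁻ q, ENNReal.ofReal (q.2 ^ 2) * ENNReal.ofReal |drift a b q.1| ∂(Λ s z) := by
  have := hΛ.sFinite s
  rw [secondMoment_apply _ (measurableSet_sep a b), hatMeasure]
  exact setLIntegral_sep_prod (Λ s z) a b (f := fun q => ENNReal.ofReal (q.2 ^ 2)) (by fun_prop)

lemma RegularAt.isCrossRegular_hatMeasure {z s : ℝ} (hreg : RegularAt Λ z s)
    (hΛ : IsLocalDensity μ Λ) : IsCrossRegular (hatMeasure Λ z s) := by
  have := hΛ.sFinite s
  have hnull : ∀ a, hatMeasure Λ z s (onLine a) = 0 := by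
    intro a
    rw [hatMeasure, Measure.prod_apply_symm (measurableSet_onLine a)]
    refine (lintegral_congr fun q => ?_).trans lintegral_zero
    refine nonpos_iff_eq_zero.1
      ((measure_mono ?_).trans_eq (Real.volume_singleton (a := a.1 - a.2 * q.1)))
    intro x hx
    simp only [onLine, offset, Set.mem_preimage, Set.mem_ofPred_eq] at hx
    simp only [Set.mem_singleton_iff]; linarith
  refine ⟨hnull, fun a b => ?_⟩
  have hle : secondMoment (hatMeasure Λ z s) (cross a b) ≤
      secondMoment (hatMeasure Λ z s) (sep a b) := by
    have hac : ∀ c, secondMoment (hatMeasure Λ z s) (onLine c) = 0 := fun c =>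
      withDensity_absolutelyContinuous _ _ (hnull c)
    refine (measure_mono (cross_subset a b)).trans ((measure_union_le _ _).trans ?_)
    rw [measure_union_null (hac a) (hac b), add_zero]
  refine hle.trans_lt ?_
  rw [secondMoment_hat_sep hΛ]
  calc ∫⁻ q, ENNReal.ofReal (q.2 ^ 2) * ENNReal.ofReal |drift a b q.1| ∂(Λ s z)
      ≤ ∫⁻ q, ENNReal.ofReal (|b.1 - a.1| + |b.2 - a.2|) *
          ENNReal.ofReal ((1 + |q.1|) * q.2 ^ 2) ∂(Λ s z) := by
        refine lintegral_mono fun q => ?_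
        rw [← ENNReal.ofReal_mul (sq_nonneg _), ← ENNReal.ofReal_mul (by positivity)]
        refine ENNReal.ofReal_le_ofReal ?_
        calc q.2 ^ 2 * |drift a b q.1|
            ≤ q.2 ^ 2 * ((|b.1 - a.1| + |b.2 - a.2|) * (1 + |q.1|)) := by
              gcongr; exact abs_drift_le a b q.1
          _ = _ := by ring
    _ < ∞ := by
        rw [lintegral_const_mul _ (by fun_prop)]
        exact ENNReal.mul_lt_top ENNReal.ofReal_lt_top hreg.finite

end LocalDensity

/-! ### Flux of lines through a short segment -/

section Flux

/-- The total weight `∫ g(v, r)` of the lines separating two points. -/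
noncomputable def flux (μ : Measure Marked) (g : ℝ × ℝ → ℝ≥0∞) (A B : Plane) : ℝ≥0∞ :=
  ∫⁻ p in sep A B, g p.2 ∂μ

variable {μ : Measure Marked} {Λ : ℝ → Kernel ℝ (ℝ × ℝ)}

lemma flux_comm (g : ℝ × ℝ → ℝ≥0∞) (A B : Plane) : flux μ g A B = flux μ g B A := by
  rw [flux, flux, sep_comm]

lemma flux_triangle (g : ℝ × ℝ → ℝ≥0∞) (A B C : Plane) :
    flux μ g A B ≤ flux μ g A C + flux μ g C B :=
  (lintegral_mono_set (sep_subset_union A B C)).trans (lintegral_union_le _ _ _)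

/-- At time `t` a line separates two simultaneous points exactly when its position lies between
them, so the disintegration at time `t` applies directly. -/
lemma IsLocalDensity.flux_horizontal (hΛ : IsLocalDensity μ Λ) {g : ℝ × ℝ → ℝ≥0∞}
    (hg : Measurable g) {x y : ℝ} (hxy : x ≤ y) (t : ℝ) :
    flux μ g (x, t) (y, t) = ∫⁻ u in Set.Ioc x y, ∫⁻ q, g q ∂(Λ t u) := by
  have hm : Measurable fun p : Marked => (Set.Ioc x y).indicator (fun _ => g p.2) p.1 := by
    have : (fun p : Marked => (Set.Ioc x y).indicator (fun _ => g p.2) p.1) =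
        (Prod.fst ⁻¹' Set.Ioc x y).indicator fun p : Marked => g p.2 := by
      ext p; simp [Set.indicator]
    rw [this]
    exact (hg.comp measurable_snd).indicator (measurable_fst measurableSet_Ioc)
  have h := hΛ.lintegral_flow t hm
  rw [flux, ← lintegral_indicator (measurableSet_sep _ _), ← lintegral_indicator measurableSet_Ioc]
  refine Eq.trans (lintegral_congr fun p => ?_) (h.trans (lintegral_congr fun u => ?_))
  · have : p ∈ sep (x, t) (y, t) ↔ p.1 + p.2.1 * t ∈ Set.Ioc x y := by
      simp only [mem_sep_iff, offset, Set.mem_Ioc]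
      constructor
      · rintro (⟨h1, h2⟩ | ⟨h1, h2⟩)
        · constructor <;> linarith
        · exfalso; linarith
      · rintro ⟨h1, h2⟩; left; constructor <;> linarith
    by_cases hp : p ∈ sep (x, t) (y, t)
    · rw [Set.indicator_of_mem hp, Set.indicator_of_mem (this.1 hp)]
    · rw [Set.indicator_of_notMem hp, Set.indicator_of_notMem (fun h => hp (this.2 h))]
  · by_cases hu : u ∈ Set.Ioc x y <;> simp [hu]

/-- The geometric core of the averaging. Both sets parametrize the same part of the line `w = -α - θ
k`, with `w` in `(0, h]` and `θ` in `(0, 1]`: one by the translation `w`, the other by the position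
`θ` on the segment. The Jacobian is `|k|`. -/
lemma volume_shift_eq (α k h : ℝ) :
    volume {w : ℝ | w ∈ Set.Ioc 0 h ∧
        ((α + w < 0 ∧ 0 ≤ α + k + w) ∨ (0 ≤ α + w ∧ α + k + w < 0))} =
      ENNReal.ofReal |k| *
        volume {θ : ℝ | θ ∈ Set.Ioc 0 1 ∧ α + θ * k < 0 ∧ 0 ≤ α + θ * k + h} := by
  rcases eq_or_ne k 0 with rfl | hk
  · simp only [add_zero, abs_zero, ENNReal.ofReal_zero, zero_mul]
    convert measure_empty (μ := volume) using 2
    ext w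
    simp only [Set.mem_ofPred_eq, Set.mem_empty_iff_false, iff_false]
    grind
  set D : Set ℝ := {w | w ∈ Set.Ioc 0 h ∧ (-α - w) / k ∈ Set.Ioc 0 1} with hD
  have hDm : MeasurableSet D :=
    (measurableSet_Ioc).inter ((by fun_prop : Measurable fun w : ℝ => (-α - w) / k)
      measurableSet_Ioc)
  have h1 : {θ : ℝ | θ ∈ Set.Ioc 0 1 ∧ α + θ * k < 0 ∧ 0 ≤ α + θ * k + h} =
      (fun θ => k * θ) ⁻¹' ((fun u => -α - u) ⁻¹' D) := by
    ext θ
    have : (-α - (-α - k * θ)) / k = θ := by field_simp; ring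
    simp only [hD, Set.mem_preimage, Set.mem_ofPred_eq, this, Set.mem_Ioc]
    constructor
    · rintro ⟨h0, h1, h2⟩; refine ⟨⟨?_, ?_⟩, h0⟩ <;> linarith
    · rintro ⟨⟨h1, h2⟩, h0⟩; refine ⟨h0, ?_, ?_⟩ <;> linarith
  rw [h1, Real.volume_preimage_mul_left hk,
    (Measure.measurePreserving_sub_left volume (-α)).measure_preimage hDm.nullMeasurableSet,
    ← mul_assoc, ← ENNReal.ofReal_mul (abs_nonneg _), ← abs_mul, mul_inv_cancel₀ hk]
  simp only [abs_one, ENNReal.ofReal_one, one_mul]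
  -- The two descriptions can disagree only at the endpoints `θ = 0` and `θ = 1`, that is at `w =
  -- -α` and `w = -α - k`.
  refine measure_congr ?_
  have e1 : ∀ᵐ w : ℝ, w ≠ -α := by simp [ae_iff]
  have e2 : ∀ᵐ w : ℝ, w ≠ -α - k := by simp [ae_iff]
  filter_upwards [e1, e2] with w h1 h2
  refine propext ?_
  change (_ ∧ _) ↔ (_ ∧ _)
  refine and_congr_right fun _ => ?_
  rw [Set.mem_Ioc]
  rcases lt_or_gt_of_ne hk with hk | hk
  · rw [lt_div_iff_of_neg hk, div_le_one_of_neg hk, zero_mul]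
    have h2' : w < -α - k ∨ -α - k < w := lt_or_gt_of_ne h2
    have h1' : w < -α ∨ -α < w := lt_or_gt_of_ne h1
    grind
  · rw [lt_div_iff₀ hk, div_le_one hk, zero_mul]
    have h2' : w < -α - k ∨ -α - k < w := lt_or_gt_of_ne h2
    have h1' : w < -α ∨ -α < w := lt_or_gt_of_ne h1
    grind

/-- The point at parameter `θ` of the segment from `A` to `B`. -/
def segPoint (A B : Plane) (θ : ℝ) : Plane := (A.1 + θ * (B.1 - A.1), A.2 + θ * (B.2 - A.2))

lemma offset_shift (A : Plane) (w : ℝ) (p : Marked) :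
    offset (A + (w, 0)) p = offset A p + w := by
  simp [offset]; ring

lemma offset_segPoint (A B : Plane) (θ : ℝ) (p : Marked) :
    offset (segPoint A B θ) p = offset A p + θ * drift A B p.2.1 := by
  simp [offset, segPoint, drift]; ring

lemma offset_add_drift (A B : Plane) (p : Marked) :
    offset A p + drift A B p.2.1 = offset B p := by
  simp [offset, drift]; ring

/-- The flux through a segment, averaged over horizontal translations of it, is an average of
fluxes through horizontal segments. -/
lemma lintegral_flux_shift [SFinite μ] {g : ℝ × ℝ → ℝ≥0∞} (hg : Measurable g) (A B : Plane)
    {h : ℝ} (hh : 0 ≤ h) :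
    ∫⁻ w in Set.Ioc 0 h, flux μ g (A + (w, 0)) (B + (w, 0)) =
      ∫⁻ θ in Set.Ioc (0 : ℝ) 1,
        flux μ (fun q => g q * ENNReal.ofReal |drift A B q.1|)
          (segPoint A B θ) (segPoint A B θ + (h, 0)) := by
  have hoff : ∀ C : Plane, Measurable fun x : ℝ × Marked => offset C x.2 := fun C =>
    (measurable_offset C).comp measurable_snd
  have hm1 : MeasurableSet {x : ℝ × Marked | x.2 ∈ sep (A + (x.1, 0)) (B + (x.1, 0))} := by
    simp only [mem_sep_iff, offset_shift]
    have hA := (hoff A).add measurable_fst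
    have hB := (hoff B).add measurable_fst
    exact ((measurableSet_lt hA measurable_const).inter
      (measurableSet_le measurable_const hB)).union
      ((measurableSet_le measurable_const hA).inter (measurableSet_lt hB measurable_const))
  have hm2 : MeasurableSet
      {x : ℝ × Marked | x.2 ∈ sep (segPoint A B x.1) (segPoint A B x.1 + (h, 0))} := by
    simp only [mem_sep_iff, offset_shift, offset_segPoint]
    have hA : Measurable fun x : ℝ × Marked => offset A x.2 + x.1 * drift A B x.2.2.1 :=
      (hoff A).add (measurable_fst.mul ((measurable_drift A B).comp (by fun_prop)))
    have hB := hA.add_const h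
    exact ((measurableSet_lt hA measurable_const).inter
      (measurableSet_le measurable_const hB)).union
      ((measurableSet_le measurable_const hA).inter (measurableSet_lt hB measurable_const))
  simp only [flux]
  have L : ∀ w, ∫⁻ p in sep (A + (w, 0)) (B + (w, 0)), g p.2 ∂μ =
      ∫⁻ p, {x : ℝ × Marked | x.2 ∈ sep (A + (x.1, 0)) (B + (x.1, 0))}.indicator
        (fun x => g x.2.2) (w, p) ∂μ := fun w => by
    rw [← lintegral_indicator (measurableSet_sep _ _)]; rfl
  have R : ∀ θ, ∫⁻ p in sep (segPoint A B θ) (segPoint A B θ + (h, 0)),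
        g p.2 * ENNReal.ofReal |drift A B p.2.1| ∂μ =
      ∫⁻ p, {x : ℝ × Marked | x.2 ∈ sep (segPoint A B x.1) (segPoint A B x.1 + (h, 0))}.indicator
        (fun x => g x.2.2 * ENNReal.ofReal |drift A B x.2.2.1|) (θ, p) ∂μ := fun θ => by
    rw [← lintegral_indicator (measurableSet_sep _ _)]; rfl
  simp_rw [L, R]
  have m1 : Measurable ({x : ℝ × Marked | x.2 ∈ sep (A + (x.1, 0)) (B + (x.1, 0))}.indicator
      (fun x => g x.2.2)) :=
    (show Measurable fun x : ℝ × Marked => g x.2.2 from hg.comp (by fun_prop)).indicator hm1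
  have m2 : Measurable ({x : ℝ × Marked | x.2 ∈ sep (segPoint A B x.1)
      (segPoint A B x.1 + (h, 0))}.indicator
      (fun x => g x.2.2 * ENNReal.ofReal |drift A B x.2.2.1|)) := by
    refine Measurable.indicator (Measurable.mul (hg.comp (by fun_prop)) ?_) hm2
    exact ((measurable_drift A B).comp (by fun_prop)).abs.ennreal_ofReal
  rw [lintegral_lintegral_swap (f := fun w p => {x : ℝ × Marked | x.2 ∈ sep (A + (x.1, 0))
        (B + (x.1, 0))}.indicator (fun x => g x.2.2) (w, p)) m1.aemeasurable,
    lintegral_lintegral_swap (f := fun θ p => {x : ℝ × Marked | x.2 ∈ sep (segPoint A B x.1)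
      (segPoint A B x.1 + (h, 0))}.indicator
      (fun x => g x.2.2 * ENNReal.ofReal |drift A B x.2.2.1|) (θ, p)) m2.aemeasurable]
  -- After exchanging the integrals the identity holds line by line, with `α` the offset of `A` and
  -- `k` the drift.
  refine lintegral_congr fun p => ?_
  have i1 : ∀ w, {x : ℝ × Marked | x.2 ∈ sep (A + (x.1, 0)) (B + (x.1, 0))}.indicator
        (fun x => g x.2.2) (w, p) =
      {w | p ∈ sep (A + (w, 0)) (B + (w, 0))}.indicator (fun _ => g p.2) w := fun w => rfl
  have i2 : ∀ θ, {x : ℝ × Marked | x.2 ∈ sep (segPoint A B x.1)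
        (segPoint A B x.1 + (h, 0))}.indicator
        (fun x => g x.2.2 * ENNReal.ofReal |drift A B x.2.2.1|) (θ, p) =
      {θ | p ∈ sep (segPoint A B θ) (segPoint A B θ + (h, 0))}.indicator
        (fun _ => g p.2 * ENNReal.ofReal |drift A B p.2.1|) θ := fun w => rfl
  simp_rw [i1, i2]
  have s1 : MeasurableSet {w : ℝ | p ∈ sep (A + (w, 0)) (B + (w, 0))} :=
    measurable_prodMk_right (y := p) hm1
  have s2 : MeasurableSet {θ : ℝ | p ∈ sep (segPoint A B θ) (segPoint A B θ + (h, 0))} :=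
    measurable_prodMk_right (y := p) hm2
  rw [lintegral_indicator_const s1, lintegral_indicator_const s2, mul_assoc,
    Measure.restrict_apply s1, Measure.restrict_apply s2]
  congr 1
  convert volume_shift_eq (offset A p) (drift A B p.2.1) h using 2
  · ext w
    simp only [mem_sep_iff, offset_shift, offset_add_drift, Set.mem_inter_iff, Set.mem_ofPred_eq]
    tauto
  · congr 1
    ext θ
    simp only [mem_sep_iff, offset_shift, offset_segPoint, Set.mem_inter_iff, Set.mem_ofPred_eq]
    grind

end Flux

section LocalLimit

variable {μ : Measure Marked} {Λ : ℝ → Kernel ℝ (ℝ × ℝ)} {z s : ℝ}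

/-- Weak continuity of the local density against functions of growth at most `(1 + |v|) r²`. -/
lemma RegularAt.tendsto_lintegral (hreg : RegularAt Λ z s) {g : ℝ × ℝ → ℝ≥0} (hg : Continuous g)
    {C : ℝ≥0} (hC : ∀ q, g q ≤ C * (1 + ‖q.1‖₊)) :
    Tendsto (fun c : Plane => ∫⁻ q, (g q : ℝ≥0∞) * ENNReal.ofReal (q.2 ^ 2) ∂(Λ c.2 c.1))
      (𝓝 (z, s)) (𝓝 (∫⁻ q, (g q : ℝ≥0∞) * ENNReal.ofReal (q.2 ^ 2) ∂(Λ s z))) := by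
  have hpos : ∀ q : ℝ × ℝ, (1 + ‖q.1‖₊ : ℝ≥0) ≠ 0 := fun q => by positivity
  -- Dividing by `1 + |v|` gives a bounded continuous test function; the factor is restored by the
  -- weight of the measure.
  have hle : ∀ q : ℝ × ℝ, g q / (1 + ‖q.1‖₊) ≤ C := fun q =>
    div_le_of_le_mul₀ zero_le zero_le (hC q)
  let φ : BoundedContinuousFunction (ℝ × ℝ) ℝ≥0 := BoundedContinuousFunction.mkOfBound
    ⟨fun q => g q / (1 + ‖q.1‖₊), hg.div (by fun_prop) hpos⟩ C (fun q q' => by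
      rw [NNReal.dist_eq, abs_le]
      have h1 : ((g q / (1 + ‖q.1‖₊) : ℝ≥0) : ℝ) ≤ C := hle q
      have h2 : ((g q' / (1 + ‖q'.1‖₊) : ℝ≥0) : ℝ) ≤ C := hle q'
      have h3 : (0 : ℝ) ≤ (g q / (1 + ‖q.1‖₊) : ℝ≥0) := NNReal.coe_nonneg _
      have h4 : (0 : ℝ) ≤ (g q' / (1 + ‖q'.1‖₊) : ℝ≥0) := NNReal.coe_nonneg _
      change -(C : ℝ) ≤ ((g q / (1 + ‖q.1‖₊) : ℝ≥0) : ℝ) - ((g q' / (1 + ‖q'.1‖₊) : ℝ≥0) : ℝ) ∧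
        ((g q / (1 + ‖q.1‖₊) : ℝ≥0) : ℝ) - ((g q' / (1 + ‖q'.1‖₊) : ℝ≥0) : ℝ) ≤ C
      constructor <;> linarith)
  have key : ∀ q : ℝ × ℝ, (φ q : ℝ≥0∞) * ENNReal.ofReal ((1 + |q.1|) * q.2 ^ 2) =
      (g q : ℝ≥0∞) * ENNReal.ofReal (q.2 ^ 2) := fun q => by
    have h1 : ENNReal.ofReal (1 + |q.1|) = ((1 + ‖q.1‖₊ : ℝ≥0) : ℝ≥0∞) := by
      rw [← ENNReal.ofReal_coe_nnreal]; simp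
    rw [ENNReal.ofReal_mul (by positivity), h1, ← mul_assoc, ← ENNReal.coe_mul]
    congr 2
    exact div_mul_cancel₀ _ (hpos q)
  simpa only [key] using hreg.continuous φ

lemma RegularAt.lintegral_lt_top (hreg : RegularAt Λ z s) {g : ℝ × ℝ → ℝ≥0}
    {C : ℝ≥0} (hC : ∀ q, g q ≤ C * (1 + ‖q.1‖₊)) :
    ∫⁻ q, (g q : ℝ≥0∞) * ENNReal.ofReal (q.2 ^ 2) ∂(Λ s z) < ∞ := by
  calc ∫⁻ q, (g q : ℝ≥0∞) * ENNReal.ofReal (q.2 ^ 2) ∂(Λ s z)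
      ≤ ∫⁻ q, (C : ℝ≥0∞) * ENNReal.ofReal ((1 + |q.1|) * q.2 ^ 2) ∂(Λ s z) := by
        refine lintegral_mono fun q => ?_
        have h1 : ENNReal.ofReal (1 + |q.1|) = ((1 + ‖q.1‖₊ : ℝ≥0) : ℝ≥0∞) := by
          rw [← ENNReal.ofReal_coe_nnreal]; simp
        rw [ENNReal.ofReal_mul (by positivity), h1, ← mul_assoc, ← ENNReal.coe_mul]
        gcongr
        exact hC q
    _ < ∞ := by
        rw [lintegral_const_mul _ (by fun_prop)]
        exact ENNReal.mul_lt_top ENNReal.coe_lt_top hreg.finite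

lemma flux_horizontal_mem_Icc (hΛ : IsLocalDensity μ Λ) {g : ℝ × ℝ → ℝ≥0∞} (hg : Measurable g)
    (A : Plane) {w : ℝ} (hw : 0 ≤ w) {l u : ℝ≥0∞}
    (h : ∀ y ∈ Set.Ioc 0 w, ∫⁻ q, g q ∂(Λ A.2 (A.1 + y)) ∈ Set.Icc l u) :
    flux μ g A (A + (w, 0)) ∈ Set.Icc (ENNReal.ofReal w * l) (ENNReal.ofReal w * u) := by
  have e : A + (w, 0) = (A.1 + w, A.2) := by ext <;> simp
  have h' : ∀ y ∈ Set.Ioc A.1 (A.1 + w), ∫⁻ q, g q ∂(Λ A.2 y) ∈ Set.Icc l u := by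
    intro y hy
    have := h (y - A.1) ⟨by linarith [hy.1], by linarith [hy.2]⟩
    rwa [add_sub_cancel] at this
  have e2 : flux μ g A (A + (w, 0)) = ∫⁻ y in Set.Ioc A.1 (A.1 + w), ∫⁻ q, g q ∂(Λ A.2 y) := by
    rw [e]; exact hΛ.flux_horizontal hg (by linarith) A.2
  rw [e2]
  have vol : volume (Set.Ioc A.1 (A.1 + w)) = ENNReal.ofReal w := by simp
  constructor
  · rw [mul_comm, ← vol, ← setLIntegral_const]
    exact setLIntegral_mono' measurableSet_Ioc fun y hy => (h' y hy).1
  · rw [mul_comm, ← vol, ← setLIntegral_const]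
    exact setLIntegral_mono' measurableSet_Ioc fun y hy => (h' y hy).2

/-- Bounds on the flux through a segment in terms of bounds on the local density nearby. -/
lemma flux_bounds [SFinite μ] (hΛ : IsLocalDensity μ Λ) {g : ℝ × ℝ → ℝ≥0∞} (hg : Measurable g)
    (A B : Plane) {h : ℝ} (hh : 0 < h) {l u C : ℝ≥0∞}
    (hseg : ∀ θ ∈ Set.Ioc (0 : ℝ) 1, ∀ y ∈ Set.Ioc 0 h,
      ∫⁻ q, g q * ENNReal.ofReal |drift A B q.1| ∂(Λ (segPoint A B θ).2 ((segPoint A B θ).1 + y))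
        ∈ Set.Icc l u)
    (hA : ∀ y ∈ Set.Ioc 0 h, ∫⁻ q, g q ∂(Λ A.2 (A.1 + y)) ≤ C)
    (hB : ∀ y ∈ Set.Ioc 0 h, ∫⁻ q, g q ∂(Λ B.2 (B.1 + y)) ≤ C) :
    l ≤ flux μ g A B + 2 * (ENNReal.ofReal h * C) ∧
      flux μ g A B ≤ u + 2 * (ENNReal.ofReal h * C) := by
  have hgm : Measurable fun q : ℝ × ℝ => g q * ENNReal.ofReal |drift A B q.1| :=
    hg.mul (by fun_prop)
  set H := ENNReal.ofReal h with hH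
  have hH0 : H ≠ 0 := by simpa [hH] using hh
  have hHt : H ≠ ∞ := ENNReal.ofReal_ne_top
  have havg : ∫⁻ w in Set.Ioc 0 h, flux μ g (A + (w, 0)) (B + (w, 0)) ∈
      Set.Icc (H * l) (H * u) := by
    rw [lintegral_flux_shift hg _ _ hh.le]
    have hθ := fun θ hθ => flux_horizontal_mem_Icc hΛ hgm (segPoint A B θ) hh.le (hseg θ hθ)
    have vol : volume (Set.Ioc (0 : ℝ) 1) = 1 := by simp
    constructor
    · calc H * l = ∫⁻ _ in Set.Ioc (0 : ℝ) 1, H * l := by rw [setLIntegral_const, vol, mul_one]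
        _ ≤ _ := setLIntegral_mono' measurableSet_Ioc fun y hy => (hθ y hy).1
    · calc _ ≤ ∫⁻ _ in Set.Ioc (0 : ℝ) 1, H * u :=
            setLIntegral_mono' measurableSet_Ioc fun y hy => (hθ y hy).2
        _ = H * u := by rw [setLIntegral_const, vol, mul_one]
  -- Cost of translating one endpoint: by the triangle inequality, only lines crossing the
  -- horizontal segment swept by that endpoint matter.
  have hend : ∀ D : Plane, (∀ y ∈ Set.Ioc 0 h, ∫⁻ q, g q ∂(Λ D.2 (D.1 + y)) ≤ C) →
      ∀ w ∈ Set.Ioc 0 h, flux μ g D (D + (w, 0)) ≤ H * C := by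
    intro D hD w hw
    have := (flux_horizontal_mem_Icc hΛ hg D hw.1.le (l := 0) (u := C)
      (fun y hy => ⟨zero_le, hD y ⟨hy.1, hy.2.trans hw.2⟩⟩)).2
    exact this.trans (by gcongr; exact ENNReal.ofReal_le_ofReal hw.2)
  have hvol : volume (Set.Ioc 0 h) = H := by simp [hH]
  have hlow : ∀ w ∈ Set.Ioc 0 h, flux μ g (A + (w, 0)) (B + (w, 0)) ≤
      flux μ g A B + 2 * (H * C) := fun w hw => by
    have t1 := flux_triangle (μ := μ) g (A + (w, 0)) (B + (w, 0)) A
    have t2 := flux_triangle (μ := μ) g A (B + (w, 0)) B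
    have a1 := hend A hA w hw
    have b1 := hend B hB w hw
    rw [flux_comm] at a1
    calc _ ≤ H * C + (flux μ g A B + H * C) := t1.trans (add_le_add a1 (t2.trans (by gcongr)))
      _ = _ := by ring
  have hupp : ∀ w ∈ Set.Ioc 0 h, flux μ g A B ≤
      flux μ g (A + (w, 0)) (B + (w, 0)) + 2 * (H * C) := fun w hw => by
    have t1 := flux_triangle (μ := μ) g A B (A + (w, 0))
    have t2 := flux_triangle (μ := μ) g (A + (w, 0)) B (B + (w, 0))
    have a1 := hend A hA w hw
    have b1 := hend B hB w hw
    rw [flux_comm] at b1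
    calc _ ≤ H * C + (flux μ g (A + (w, 0)) (B + (w, 0)) + H * C) :=
          t1.trans (add_le_add a1 (t2.trans (by gcongr)))
      _ = _ := by ring
  constructor
  · refine (ENNReal.mul_le_mul_iff_right hH0 hHt).1 (havg.1.trans ?_)
    calc _ ≤ ∫⁻ _ in Set.Ioc 0 h, (flux μ g A B + 2 * (H * C)) :=
          setLIntegral_mono' measurableSet_Ioc hlow
      _ = _ := by rw [setLIntegral_const, hvol, mul_comm]
  · refine (ENNReal.mul_le_mul_iff_right hH0 hHt).1 ?_
    calc H * flux μ g A B = ∫⁻ _ in Set.Ioc 0 h, flux μ g A B := by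
          rw [setLIntegral_const, hvol, mul_comm]
      _ ≤ ∫⁻ w in Set.Ioc 0 h, (flux μ g (A + (w, 0)) (B + (w, 0)) + 2 * (H * C)) :=
          setLIntegral_mono' measurableSet_Ioc hupp
      _ = (∫⁻ w in Set.Ioc 0 h, flux μ g (A + (w, 0)) (B + (w, 0))) + H * (2 * (H * C)) := by
          rw [lintegral_add_right _ measurable_const, setLIntegral_const, hvol,
            mul_comm (2 * (H * C)) H]
      _ ≤ H * u + H * (2 * (H * C)) := by gcongr; exact havg.2
      _ = _ := by ring

lemma drift_smul (ε : ℝ) (a b c : Plane) (v : ℝ) :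
    drift (ε • a + c) (ε • b + c) v = ε * drift a b v := by
  simp [drift]; ring

/-- The flux through a small segment near a regular point. -/
theorem RegularAt.tendsto_flux [SFinite μ] (hΛ : IsLocalDensity μ Λ) (hreg : RegularAt Λ z s)
    {g : ℝ × ℝ → ℝ≥0} (hg : Continuous g) {C : ℝ≥0} (hC : ∀ q, g q ≤ C) (a b : Plane) :
    Tendsto (fun ε : ℝ => flux μ (fun q => (g q : ℝ≥0∞) * ENNReal.ofReal (q.2 ^ 2))
        (ε • a + (z, s)) (ε • b + (z, s)) / ENNReal.ofReal ε) (𝓝[>] 0)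
      (𝓝 (flux (hatMeasure Λ z s) (fun q => (g q : ℝ≥0∞) * ENNReal.ofReal (q.2 ^ 2)) a b)) := by
  have := hΛ.sFinite s
  set G : ℝ × ℝ → ℝ≥0∞ := fun q => (g q : ℝ≥0∞) * ENNReal.ofReal (q.2 ^ 2) with hG
  have hGm : Measurable G := by fun_prop
  have hone : ∀ q : ℝ × ℝ, (1 : ℝ≥0) ≤ 1 + ‖q.1‖₊ := fun q => le_add_of_nonneg_right zero_le
  have hC' : ∀ q, g q ≤ C * (1 + ‖q.1‖₊) := fun q =>
    (hC q).trans (le_mul_of_one_le_right zero_le (hone q))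
  let k : ℝ × ℝ → ℝ≥0 := fun q => g q * ‖drift a b q.1‖₊
  have hk : Continuous k := hg.mul (by fun_prop)
  have hkC : ∀ q, k q ≤ C * (‖b.1 - a.1‖₊ + ‖b.2 - a.2‖₊) * (1 + ‖q.1‖₊) := fun q => by
    rw [mul_assoc]
    exact mul_le_mul (hC q) (abs_drift_le a b q.1) zero_le zero_le
  have hkG : ∀ q : ℝ × ℝ, (k q : ℝ≥0∞) * ENNReal.ofReal (q.2 ^ 2) =
      G q * ENNReal.ofReal |drift a b q.1| := fun q => by
    have : ENNReal.ofReal |drift a b q.1| = ‖drift a b q.1‖₊ := by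
      rw [← ENNReal.ofReal_coe_nnreal]; simp
    simp only [k, hG, this, ENNReal.coe_mul]; ring
  have hL : flux (hatMeasure Λ z s) G a b = ∫⁻ q, (k q : ℝ≥0∞) * ENNReal.ofReal (q.2 ^ 2) ∂(Λ s z) := by
    simp only [hkG]
    exact setLIntegral_sep_prod (Λ s z) a b hGm
  rw [hL]
  have lim1 := hreg.tendsto_lintegral hk hkC
  have lim2 := hreg.tendsto_lintegral hg hC'
  set L := ∫⁻ q, (k q : ℝ≥0∞) * ENNReal.ofReal (q.2 ^ 2) ∂(Λ s z) with hLdef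
  have hLt : L ≠ ∞ := (hreg.lintegral_lt_top hkC).ne
  have hMt : ∫⁻ q, G q ∂(Λ s z) ≠ ∞ := (hreg.lintegral_lt_top hC').ne
  set M : ℝ≥0∞ := ∫⁻ q, G q ∂(Λ s z) + 1 with hM
  have hMtop : M ≠ ∞ := by simp [hM, hMt]
  -- The tolerance is split in two halves: one for the variation of the local density near `(z, s)`,
  -- one for the endpoint corrections.
  rw [ENNReal.tendsto_nhds hLt]
  intro τ hτ
  obtain ⟨τ', hτ', hττ⟩ : ∃ τ' : ℝ≥0, 0 < τ' ∧ (τ' : ℝ≥0∞) + τ' ≤ τ := by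
    obtain ⟨t, ht0, ht⟩ := ENNReal.lt_iff_exists_nnreal_btwn.1 hτ
    refine ⟨t / 2, by simpa using ht0, ?_⟩
    rw [← ENNReal.coe_add, add_halves]; exact ht.le
  -- Translations have length up to `εδ`, so the endpoint corrections relative to `ε` are at most
  -- `2δM`, uniformly in `ε`.
  obtain ⟨δ, hδ, hδM⟩ : ∃ δ : ℝ, 0 < δ ∧ 2 * (ENNReal.ofReal δ * M) ≤ τ' := by
    lift M to ℝ≥0 using hMtop with m
    have hm : (1 : ℝ) ≤ m := by
      have : (1 : ℝ≥0∞) ≤ m := by rw [hM]; exact le_add_self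
      exact_mod_cast this
    refine ⟨τ' / (2 * m), by positivity, ?_⟩
    rw [← ENNReal.ofReal_coe_nnreal (p := m), ← ENNReal.ofReal_mul (by positivity),
      show (2 : ℝ≥0∞) = ENNReal.ofReal 2 by simp, ← ENNReal.ofReal_mul (by positivity),
      ← ENNReal.ofReal_coe_nnreal (p := τ')]
    refine ENNReal.ofReal_le_ofReal (le_of_eq ?_)
    field_simp
  have ev1 : ∀ᶠ c : Plane in 𝓝 (z, s), ∫⁻ q, (k q : ℝ≥0∞) * ENNReal.ofReal (q.2 ^ 2) ∂(Λ c.2 c.1)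
      ∈ Set.Icc (L - τ') (L + τ') :=
    (ENNReal.tendsto_nhds hLt).1 lim1 τ' (by exact_mod_cast hτ')
  have ev2 : ∀ᶠ c : Plane in 𝓝 (z, s), ∫⁻ q, G q ∂(Λ c.2 c.1) ≤ M :=
    ((ENNReal.tendsto_nhds hMt).1 lim2 1 one_pos).mono fun c hc => hc.2
  obtain ⟨r, hr, hball⟩ := Metric.eventually_nhds_iff_ball.1 (ev1.and ev2)
  -- All points of the translated segments lie within `εR` of `(z, s)`.
  set R : ℝ := ‖a‖ + ‖b - a‖ + δ with hR
  have hR0 : 0 < R := by positivity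
  have hev : ∀ᶠ ε : ℝ in 𝓝[>] 0, ε < r / R :=
    (eventually_lt_nhds (by positivity)).filter_mono nhdsWithin_le_nhds
  filter_upwards [hev, self_mem_nhdsWithin] with ε hε hε0
  have hε0 : 0 < ε := hε0
  have hεR : ε * R < r := (lt_div_iff₀ hR0).1 hε
  set A : Plane := ε • a + (z, s) with hA
  set B : Plane := ε • b + (z, s) with hB
  have hnear : ∀ θ ∈ Set.Icc (0 : ℝ) 1, ∀ y ∈ Set.Ioc 0 (ε * δ),
      ((segPoint A B θ).1 + y, (segPoint A B θ).2) ∈ Metric.ball ((z, s) : Plane) r := by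
    intro θ hθ y hy
    have e : ((segPoint A B θ).1 + y, (segPoint A B θ).2) - ((z, s) : Plane) =
        ε • a + (θ * ε) • (b - a) + (y, 0) := by
      ext <;> simp [segPoint, hA, hB] <;> ring
    rw [Metric.mem_ball, dist_eq_norm, e]
    have hn1 : ‖((y, 0) : Plane)‖ ≤ ε * δ := by
      rw [Prod.norm_def]; simp [abs_of_pos hy.1, hy.2, hy.1.le]
    have hn2 : ‖(θ * ε) • (b - a)‖ ≤ ε * ‖b - a‖ := by
      rw [norm_smul, norm_mul, Real.norm_of_nonneg hθ.1, Real.norm_of_nonneg hε0.le]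
      gcongr
      exact mul_le_of_le_one_left hε0.le hθ.2
    have hn3 : ‖ε • a‖ ≤ ε * ‖a‖ := by rw [norm_smul, Real.norm_of_nonneg hε0.le]
    calc _ ≤ ‖ε • a‖ + ‖(θ * ε) • (b - a)‖ + ‖((y, 0) : Plane)‖ := norm_add₃_le
      _ ≤ ε * ‖a‖ + ε * ‖b - a‖ + ε * δ := by gcongr
      _ = ε * R := by rw [hR]; ring
      _ < r := hεR
  have E0 : ENNReal.ofReal ε ≠ 0 := by simpa using hε0
  have Et : ENNReal.ofReal ε ≠ ∞ := ENNReal.ofReal_ne_top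
  have hb := flux_bounds (μ := μ) hΛ hGm A B (mul_pos hε0 hδ)
    (l := ENNReal.ofReal ε * (L - τ')) (u := ENNReal.ofReal ε * (L + τ')) (C := M)
    (fun θ hθ y hy => by
      have := (hball _ (hnear θ ⟨hθ.1.le, hθ.2⟩ y hy)).1
      simp only [hkG] at this
      have e : ∀ q : ℝ × ℝ, G q * ENNReal.ofReal |drift A B q.1| =
          ENNReal.ofReal ε * (G q * ENNReal.ofReal |drift a b q.1|) := fun q => by
        rw [hA, hB, drift_smul, abs_mul, abs_of_pos hε0, ENNReal.ofReal_mul hε0.le]; ring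
      simp only [e]
      rw [lintegral_const_mul _ (show Measurable fun q : ℝ × ℝ =>
        G q * ENNReal.ofReal |drift a b q.1| from hGm.mul (by fun_prop))]
      exact ⟨by gcongr; exact this.1, by gcongr; exact this.2⟩)
    (fun y hy => by
      have := (hball _ (hnear 0 ⟨le_rfl, zero_le_one⟩ y hy)).2
      simpa [segPoint] using this)
    (fun y hy => by
      have := (hball _ (hnear 1 ⟨zero_le_one, le_rfl⟩ y hy)).2
      simpa [segPoint] using this)
  have hmul : 2 * (ENNReal.ofReal (ε * δ) * M) =
      ENNReal.ofReal ε * (2 * (ENNReal.ofReal δ * M)) := by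
    rw [ENNReal.ofReal_mul hε0.le]; ring
  rw [hmul] at hb
  have hF : flux μ G A B = ENNReal.ofReal ε * (flux μ G A B / ENNReal.ofReal ε) :=
    (ENNReal.mul_div_cancel E0 Et).symm
  rw [hF, ← mul_add, ← mul_add, ENNReal.mul_le_mul_iff_right E0 Et,
    ENNReal.mul_le_mul_iff_right E0 Et] at hb
  constructor
  · rw [tsub_le_iff_right]
    calc L ≤ L - τ' + τ' := le_tsub_add
      _ ≤ flux μ G A B / ENNReal.ofReal ε + τ' + τ' := by
          gcongr; exact hb.1.trans (by gcongr)
      _ ≤ _ := by rw [add_assoc]; gcongr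
  · calc _ ≤ L + τ' + τ' := hb.2.trans (by gcongr)
      _ ≤ _ := by rw [add_assoc]; gcongr

end LocalLimit

/-! ### Characteristic functionals of Poisson processes -/

section Poisson

lemma lintegral_empirical (X : Set Marked) {f : Marked → ℝ≥0∞} (hf : Measurable f) :
    ∫⁻ p, f p ∂(empirical X) = ∑' p : X, f p := by
  rw [empirical, lintegral_sum_measure]
  congr with p
  rw [lintegral_dirac' _ hf]

/-- A finite count means finitely many points in `S`, so the integral is a finite sum and no bound
on `f` is needed. -/
lemma integrable_empirical {X : Set Marked} {S : Set Marked} (hS : MeasurableSet S)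
    (hX : empirical X S ≠ ∞) {f : Marked → ℝ} (hf : Measurable f) (hfS : ∀ p ∉ S, f p = 0) :
    Integrable f (empirical X) := by
  refine ⟨hf.aestronglyMeasurable, ?_⟩
  rw [HasFiniteIntegral, lintegral_empirical X (by fun_prop)]
  have h1 : ∑' p : X, S.indicator (1 : Marked → ℝ≥0∞) p ≠ ∞ := by
    rwa [← lintegral_empirical X (measurable_one.indicator hS), lintegral_indicator_one hS]
  have hfin := ENNReal.finite_const_le_of_tsum_ne_top h1 one_ne_zero
  rw [tsum_eq_sum (s := hfin.toFinset)]
  · exact ENNReal.sum_lt_top.2 fun p _ => enorm_lt_top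
  · intro p hp
    have : (p : Marked) ∉ S := fun h => hp (by simp [h])
    simp [hfS _ this]

/-- Lower integrals are measurable in the measure. The case distinction reproduces the value `0` of
the Bochner integral of a non-integrable function. -/
lemma measurable_integral_of_measurable {f : Marked → ℝ} (hf : Measurable f) :
    Measurable fun m : Measure Marked => ∫ p, f p ∂m := by
  classical
  have h0 : Measurable fun m : Measure Marked => ∫⁻ p, ‖f p‖ₑ ∂m :=
    Measure.measurable_lintegral (by fun_prop)
  have h1 : Measurable fun m : Measure Marked => ∫⁻ p, ENNReal.ofReal (f p) ∂m :=
    Measure.measurable_lintegral (by fun_prop)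
  have h2 : Measurable fun m : Measure Marked => ∫⁻ p, ENNReal.ofReal (-f p) ∂m :=
    Measure.measurable_lintegral (by fun_prop)
  have e : (fun m : Measure Marked => ∫ p, f p ∂m) = fun m =>
      if ∫⁻ p, ‖f p‖ₑ ∂m < ∞ then
        (∫⁻ p, ENNReal.ofReal (f p) ∂m).toReal - (∫⁻ p, ENNReal.ofReal (-f p) ∂m).toReal
      else 0 := by
    ext m
    split_ifs with h
    · exact integral_eq_lintegral_pos_part_sub_lintegral_neg_part ⟨hf.aestronglyMeasurable, h⟩
    · exact integral_undef fun hi => h hi.2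
  rw [e]
  exact Measurable.ite (measurableSet_lt h0 measurable_const)
    (h1.ennreal_toReal.sub h2.ennreal_toReal) measurable_const

/-- The condition `F 0 = 0` removes the level set over `0`, the only one that may have infinite
measure. -/
lemma SimpleFunc_comp_eq_sum {E : Type*} [AddCommMonoid E] (g : SimpleFunc Marked ℝ) (F : ℝ → E)
    (hF : F 0 = 0) (p : Marked) :
    F (g p) = ∑ c ∈ g.range.filter (· ≠ 0), (g ⁻¹' {c}).indicator (fun _ => F c) p := by
  classical
  by_cases h : g p = 0
  · rw [h, hF]
    refine (Finset.sum_eq_zero fun c hc => ?_).symm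
    rw [Set.indicator_of_notMem]
    intro hp
    have : g p = c := hp
    exact (Finset.mem_filter.1 hc).2 (this ▸ h)
  · rw [Finset.sum_eq_single (g p)]
    · simp
    · intro c _ hc
      rw [Set.indicator_of_notMem]
      exact fun hp => hc (show g p = c from hp).symm
    · intro hn
      exact absurd (Finset.mem_filter.2 ⟨g.mem_range_self p, h⟩) hn

lemma integral_comp_simpleFunc {E : Type*} [NormedAddCommGroup E] [NormedSpace ℝ E]
    [CompleteSpace E] (m : Measure Marked) (g : SimpleFunc Marked ℝ) (F : ℝ → E)
    (hF : F 0 = 0) (hm : ∀ c ≠ 0, m (g ⁻¹' {c}) ≠ ∞) :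
    ∫ p, F (g p) ∂m = ∑ c ∈ g.range.filter (· ≠ 0), m.real (g ⁻¹' {c}) • F c := by
  simp_rw [SimpleFunc_comp_eq_sum g F hF]
  rw [integral_finsetSum]
  · refine Finset.sum_congr rfl fun c _ => ?_
    rw [integral_indicator_const _ (g.measurableSet_fiber c)]
  · intro c hc
    rw [integrable_indicator_iff (g.measurableSet_fiber c)]
    exact integrableOn_const (hm c (Finset.mem_filter.1 hc).2)

variable {Ω : Type*} [MeasurableSpace Ω] {P : Measure Ω} {X : Ω → Set Marked} {ν : Measure Marked}

lemma IsPoissonProcess.measurable_empirical (hX : IsPoissonProcess P X ν) :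
    Measurable fun ω => empirical (X ω) :=
  Measure.measurable_of_measurable_coe _ hX.measurable

lemma IsPoissonProcess.measurable_integral (hX : IsPoissonProcess P X ν) {f : Marked → ℝ}
    (hf : Measurable f) : Measurable fun ω => ∫ p, f p ∂(empirical (X ω)) :=
  (measurable_integral_of_measurable hf).comp hX.measurable_empirical

lemma IsPoissonProcess.ae_lt_top (hX : IsPoissonProcess P X ν) {A : Set Marked}
    (hA : MeasurableSet A) (hνA : ν A < ∞) : ∀ᵐ ω ∂P, empirical (X ω) A < ∞ := by
  have h : ∀ᵐ x ∂(P.map fun ω => empirical (X ω) A), x < ∞ := by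
    rw [hX.law A hA hνA]
    exact (ae_map_iff (p := fun x => x < ∞) .of_discrete measurableSet_Iio).2
      (ae_of_all _ fun n => ENNReal.natCast_lt_top n)
  exact ae_of_ae_map (hX.measurable A hA).aemeasurable h

lemma IsPoissonProcess.charFun_apply (hX : IsPoissonProcess P X ν) {A : Set Marked}
    (hA : MeasurableSet A) (hνA : ν A < ∞) (c : ℝ) :
    ∫ ω, Complex.exp (((empirical (X ω)).real A * c : ℝ) * Complex.I) ∂P =
      Complex.exp (ν.real A * (Complex.exp (c * Complex.I) - 1)) := by
  have h1 : P.map (fun ω => (empirical (X ω)).real A) =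
      (poissonMeasure (ν A).toNNReal).map (Nat.cast : ℕ → ℝ) := by
    have : (fun ω => (empirical (X ω)).real A) =
        ENNReal.toReal ∘ fun ω => empirical (X ω) A := rfl
    rw [this, ← Measure.map_map ENNReal.measurable_toReal (hX.measurable A hA),
      hX.law A hA hνA, Measure.map_map ENNReal.measurable_toReal .of_discrete]
    congr 1
  have h2 := charFun_map_cast_poissonMeasure (ν A).toNNReal c
  have hm : Measurable fun ω => (empirical (X ω)).real A := (hX.measurable A hA).ennreal_toReal
  rw [← h1, charFun_apply_real, integral_map hm.aemeasurable (by fun_prop)] at h2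
  rw [show ((ν.real A : ℝ) : ℂ) = (((ν A).toNNReal : ℝ) : ℂ) from rfl, ← h2]
  congr with ω
  push_cast
  ring_nf

/-- Nonzero level sets are disjoint, so their counts are independent Poisson variables and the
characteristic function factorizes. -/
lemma IsPoissonProcess.charFun_simpleFunc (hX : IsPoissonProcess P X ν)
    (g : SimpleFunc Marked ℝ) (hν : ∀ c ≠ 0, ν (g ⁻¹' {c}) < ∞) :
    ∫ ω, Complex.exp ((∫ p, g p ∂(empirical (X ω)) : ℝ) * Complex.I) ∂P =
      Complex.exp (∫ p, (Complex.exp (g p * Complex.I) - 1) ∂ν) := by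
  classical
  set s := g.range.filter (· ≠ 0) with hs
  have hs0 : ∀ c : s, (c : ℝ) ≠ 0 := fun c => (Finset.mem_filter.1 c.2).2
  have hind : iIndepFun (fun (c : s) ω => empirical (X ω) (g ⁻¹' {(c : ℝ)})) P := by
    have h := hX.indep s.card (fun i => g ⁻¹' {((s.equivFin.symm i : s) : ℝ)})
      (fun i => g.measurableSet_fiber _) (fun i j hij => by
        refine Disjoint.preimage _ ?_
        rw [Set.disjoint_singleton]
        exact fun h => hij (s.equivFin.symm.injective (Subtype.ext h)))
    have h' := h.precomp s.equivFin.injective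
    simpa using h'
  have hsum : ∀ᵐ ω ∂P, ∫ p, g p ∂(empirical (X ω)) =
      ∑ c : s, (empirical (X ω)).real (g ⁻¹' {(c : ℝ)}) * c := by
    have : ∀ᵐ ω ∂P, ∀ c : s, empirical (X ω) (g ⁻¹' {(c : ℝ)}) < ∞ :=
      ae_all_iff.2 fun c => hX.ae_lt_top (g.measurableSet_fiber _) (hν c (hs0 c))
    filter_upwards [this] with ω hω
    rw [integral_comp_simpleFunc _ g (fun x => x) rfl, ← Finset.sum_coe_sort]
    · rfl
    · intro c hc
      by_cases hcr : c ∈ s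
      · exact (hω ⟨c, hcr⟩).ne
      · have : g ⁻¹' {c} = ∅ := by
          ext p
          simp only [Set.mem_preimage, Set.mem_singleton_iff, Set.mem_empty_iff_false, iff_false]
          rintro rfl
          exact hcr (Finset.mem_filter.2 ⟨g.mem_range_self p, hc⟩)
        simp [this]
  have e1 : ∫ ω, Complex.exp ((∫ p, g p ∂(empirical (X ω)) : ℝ) * Complex.I) ∂P =
      ∫ ω, ∏ c : s, Complex.exp
        (((empirical (X ω)).real (g ⁻¹' {(c : ℝ)}) * c : ℝ) * Complex.I) ∂P := by
    refine integral_congr_ae ?_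
    filter_upwards [hsum] with ω hω
    rw [hω, ← Complex.exp_sum]
    push_cast
    rw [Finset.sum_mul]
  rw [e1]
  have e2 := hind.integral_fun_prod_comp (𝕜 := ℂ)
    (f := fun (c : s) (x : ℝ≥0∞) => Complex.exp ((x.toReal * c : ℝ) * Complex.I))
    (fun c => (hX.measurable _ (g.measurableSet_fiber _)).aemeasurable)
    (fun c => Measurable.aestronglyMeasurable (by fun_prop))
  refine e2.trans ?_
  rw [integral_comp_simpleFunc ν g (fun x : ℝ => Complex.exp (x * Complex.I) - 1) (by simp)
    (fun c hc => (hν c hc).ne), Complex.exp_sum]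
  refine Eq.trans ?_ (Finset.prod_coe_sort s fun c =>
    Complex.exp (ν.real (g ⁻¹' {c}) • (Complex.exp (c * Complex.I) - 1)))
  refine Finset.prod_congr rfl fun c _ => ?_
  rw [Complex.real_smul]
  exact hX.charFun_apply (g.measurableSet_fiber _) (hν c (hs0 c)) c

variable [IsProbabilityMeasure P]

/-- The characteristic functional of a Poisson process. -/
theorem IsPoissonProcess.charFun_integral (hX : IsPoissonProcess P X ν) {S : Set Marked}
    (hS : MeasurableSet S) (hνS : ν S < ∞) {f : Marked → ℝ} (hf : Measurable f)
    (hfS : ∀ p ∉ S, f p = 0) :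
    ∫ ω, Complex.exp ((∫ p, f p ∂(empirical (X ω)) : ℝ) * Complex.I) ∂P =
      Complex.exp (∫ p, (Complex.exp (f p * Complex.I) - 1) ∂ν) := by
  let g : ℕ → SimpleFunc Marked ℝ := SimpleFunc.approxOn f hf Set.univ 0 (Set.mem_univ _)
  have hbound : ∀ n p, ‖g n p‖ ≤ ‖f p‖ + ‖f p‖ := fun n p =>
    SimpleFunc.norm_approxOn_zero_le hf (Set.mem_univ _) p n
  have hlim : ∀ p, Tendsto (fun n => g n p) atTop (𝓝 (f p)) := fun p =>
    SimpleFunc.tendsto_approxOn hf (Set.mem_univ _) (by simp)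
  -- The approximants are dominated by `2|f|`, so they inherit the support. This keeps their nonzero
  -- level sets of finite intensity and supplies the dominating functions.
  have hgS : ∀ n, ∀ p ∉ S, g n p = 0 := fun n p hp => by
    have := hbound n p
    rw [hfS p hp] at this
    simpa using this
  have hgν : ∀ n, ∀ c ≠ 0, ν (g n ⁻¹' {c}) < ∞ := fun n c hc => by
    refine (measure_mono fun p hp => ?_).trans_lt hνS
    by_contra hpS
    exact hc ((show g n p = c from hp) ▸ hgS n p hpS)
  have hfin := hX.ae_lt_top hS hνS
  have hN : ∀ᵐ ω ∂P, Tendsto (fun n => ∫ p, g n p ∂(empirical (X ω))) atTop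
      (𝓝 (∫ p, f p ∂(empirical (X ω)))) := by
    filter_upwards [hfin] with ω hω
    have hfi := integrable_empirical hS hω.ne hf hfS
    exact tendsto_integral_of_dominated_convergence (fun p => ‖f p‖ + ‖f p‖)
      (fun n => (g n).aestronglyMeasurable) (hfi.norm.add hfi.norm)
      (fun n => ae_of_all _ (hbound n)) (ae_of_all _ hlim)
  have L1 : Tendsto (fun n => ∫ ω, Complex.exp ((∫ p, g n p ∂(empirical (X ω)) : ℝ) * Complex.I) ∂P)
      atTop (𝓝 (∫ ω, Complex.exp ((∫ p, f p ∂(empirical (X ω)) : ℝ) * Complex.I) ∂P)) := by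
    refine tendsto_integral_of_dominated_convergence (fun _ => (1 : ℝ)) (fun n => ?_)
      (integrable_const _) (fun n => ae_of_all _ fun ω => ?_) ?_
    · have := hX.measurable_integral (g n).measurable
      exact Measurable.aestronglyMeasurable (by fun_prop)
    · rw [Complex.norm_exp_ofReal_mul_I]
    · filter_upwards [hN] with ω hω
      exact (Complex.continuous_exp.tendsto _).comp
        (((Complex.continuous_ofReal.tendsto _).comp hω).mul_const _)
  have L2 : Tendsto (fun n => ∫ p, (Complex.exp (g n p * Complex.I) - 1) ∂ν) atTop
      (𝓝 (∫ p, (Complex.exp (f p * Complex.I) - 1) ∂ν)) := by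
    refine tendsto_integral_of_dominated_convergence (S.indicator fun _ => (2 : ℝ)) (fun n => ?_)
      ((integrable_indicator_iff hS).2 (integrableOn_const hνS.ne)) (fun n => ae_of_all _ fun p => ?_)
      (ae_of_all _ fun p => ?_)
    · have := (g n).measurable
      exact Measurable.aestronglyMeasurable (by fun_prop)
    · by_cases hp : p ∈ S
      · rw [Set.indicator_of_mem hp]
        refine (norm_sub_le _ _).trans ?_
        rw [Complex.norm_exp_ofReal_mul_I]
        norm_num
      · simp [hp, hgS n p hp]
    · exact ((Complex.continuous_exp.tendsto _).comp
        (((Complex.continuous_ofReal.tendsto _).comp (hlim p)).mul_const _)).sub_const _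
  refine tendsto_nhds_unique L1 ?_
  simp_rw [fun n => hX.charFun_simpleFunc (g n) (hgν n)]
  exact (Complex.continuous_exp.tendsto _).comp L2

/-- The characteristic functional of a compensated Poisson process. -/
theorem IsPoissonProcess.charFun_compensated (hX : IsPoissonProcess P X ν) {S : Set Marked}
    (hS : MeasurableSet S) (hνS : ν S < ∞) {f : Marked → ℝ} (hf : Measurable f)
    (hfS : ∀ p ∉ S, f p = 0) (hfi : Integrable f ν) :
    ∫ ω, Complex.exp ((∫ p, f p ∂(empirical (X ω)) - ∫ p, f p ∂ν : ℝ) * Complex.I) ∂P =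
      Complex.exp (∫ p, (Complex.exp (f p * Complex.I) - 1 - f p * Complex.I) ∂ν) := by
  have hi1 : Integrable (fun p => Complex.exp (f p * Complex.I) - 1) ν := by
    refine Integrable.mono' (g := S.indicator fun _ => (2 : ℝ))
      ((integrable_indicator_iff hS).2 (integrableOn_const hνS.ne))
      (Measurable.aestronglyMeasurable (by fun_prop)) (ae_of_all _ fun p => ?_)
    by_cases hp : p ∈ S
    · rw [Set.indicator_of_mem hp]
      refine (norm_sub_le _ _).trans ?_
      rw [Complex.norm_exp_ofReal_mul_I]
      norm_num
    · simp [hp, hfS p hp]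
  have hi2 : Integrable (fun p => (f p : ℂ) * Complex.I) ν := hfi.ofReal.mul_const _
  have e : ∫ p, (f p : ℂ) ∂ν = ((∫ p, f p ∂ν : ℝ) : ℂ) := integral_ofReal
  rw [integral_sub hi1 hi2, Complex.exp_sub, integral_mul_const, e, ← hX.charFun_integral hS hνS hf hfS, ← integral_div]
  congr with ω
  rw [← Complex.exp_sub]
  push_cast
  ring_nf

end Poisson

/-! ### Gaussian processes with prescribed covariance -/

section Gaussian

lemma norm_exp_mul_I_sub_le (x y : ℝ) :
    ‖Complex.exp (x * Complex.I) - Complex.exp (y * Complex.I)‖ ≤ |x - y| := by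
  have h : Complex.exp (x * Complex.I) - Complex.exp (y * Complex.I) =
      Complex.exp (y * Complex.I) * (Complex.exp (Complex.I * ((x - y : ℝ) : ℂ)) - 1) := by
    rw [mul_sub, ← Complex.exp_add]
    push_cast
    ring_nf
  rw [h, norm_mul, Complex.norm_exp_ofReal_mul_I, one_mul]
  exact Real.norm_exp_I_mul_ofReal_sub_one_le

/-- The characteristic function of a square integrable random variable at `1`. -/
noncomputable def charOne {Ω : Type*} [MeasurableSpace Ω] {P : Measure Ω} (Y : Lp ℝ 2 P) : ℂ :=
  ∫ ω, Complex.exp (Y ω * Complex.I) ∂P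

variable {Ω : Type*} [MeasurableSpace Ω] {P : Measure Ω} [IsProbabilityMeasure P]

lemma integrable_exp_mul_I {f : Ω → ℝ} (hf : AEStronglyMeasurable f P) :
    Integrable (fun ω => Complex.exp (f ω * Complex.I)) P := by
  refine Integrable.of_bound (C := 1) ?_ (ae_of_all _ fun ω => ?_)
  · exact Complex.continuous_exp.comp_aestronglyMeasurable
      ((Complex.continuous_ofReal.comp_aestronglyMeasurable hf).mul_const _)
  · rw [Complex.norm_exp_ofReal_mul_I]

/-- The exponential is 1-Lipschitz on the imaginary axis and the `L¹` norm is at most the `L²` norm.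
This carries Gaussian characteristic functions from finite sums to `L²` limits. -/
lemma lipschitzWith_charOne : LipschitzWith 1 (charOne : Lp ℝ 2 P → ℂ) := by
  refine LipschitzWith.of_dist_le_mul fun Y Z => ?_
  rw [NNReal.coe_one, one_mul, dist_eq_norm, dist_eq_norm, charOne, charOne,
    ← integral_sub (integrable_exp_mul_I (Lp.aestronglyMeasurable Y))
      (integrable_exp_mul_I (Lp.aestronglyMeasurable Z))]
  have hi : Integrable (Y - Z : Lp ℝ 2 P) P :=
    (Lp.memLp (Y - Z)).integrable (by norm_num)
  have hco : ∀ᵐ ω ∂P, (Y - Z : Lp ℝ 2 P) ω = Y ω - Z ω := Lp.coeFn_sub Y Z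
  calc ‖∫ ω, (Complex.exp (Y ω * Complex.I) - Complex.exp (Z ω * Complex.I)) ∂P‖
      ≤ ∫ ω, ‖(Y - Z : Lp ℝ 2 P) ω‖ ∂P := by
        refine norm_integral_le_of_norm_le hi.norm ?_
        filter_upwards [hco] with ω hω
        rw [hω]
        exact norm_exp_mul_I_sub_le _ _
    _ = (eLpNorm (Y - Z : Lp ℝ 2 P) 1 P).toReal := by
        rw [integral_norm_eq_lintegral_enorm (Lp.aestronglyMeasurable _),
          eLpNorm_one_eq_lintegral_enorm]
    _ ≤ (eLpNorm (Y - Z : Lp ℝ 2 P) 2 P).toReal :=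
        ENNReal.toReal_mono (Lp.eLpNorm_ne_top _)
          (eLpNorm_le_eLpNorm_of_exponent_le (by norm_num) (Lp.aestronglyMeasurable _))
    _ = ‖Y - Z‖ := (Lp.norm_def _).symm

/-- An isometry of a Hilbert space into the square integrable random variables is Gaussian if every
variable of its range has the Gaussian characteristic function. -/
lemma map_eq_gaussianReal_of_charOne {H : Type*} [NormedAddCommGroup H] [InnerProductSpace ℝ H]
    (W : H →ₗᵢ[ℝ] Lp ℝ 2 P) (hW : ∀ h, charOne (W h) = Complex.exp (-(‖h‖ ^ 2 / 2 : ℝ))) (h : H) :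
    P.map (W h) = gaussianReal 0 (‖h‖₊ ^ 2) := by
  have hm := (Lp.stronglyMeasurable (W h)).measurable
  have := Measure.isProbabilityMeasure_map (μ := P) hm.aemeasurable
  refine Measure.ext_of_charFun ?_
  ext t
  rw [charFun_gaussianReal, charFun_apply_real, integral_map hm.aemeasurable (by fun_prop)]
  have h1 := hW (t • h)
  have h2 : charOne (W (t • h)) = ∫ ω, Complex.exp (t * W h ω * Complex.I) ∂P := by
    rw [charOne]
    refine integral_congr_ae ?_
    rw [map_smul]
    filter_upwards [Lp.coeFn_smul t (W h)] with ω hω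
    rw [hω]
    simp
  rw [← h2, h1, norm_smul]
  congr 1
  simp only [Real.norm_eq_abs, mul_pow, sq_abs]
  push_cast
  ring

/-- A Hilbert basis is sent to independent standard normal coordinates, an orthonormal family in
`L²`. Finite combinations are Gaussian by independence, and the other vectors follow by continuity
of `charOne`. -/
theorem exists_gaussian_isometry (H : Type) [NormedAddCommGroup H] [InnerProductSpace ℝ H]
    [CompleteSpace H] :
    ∃ (Ω : Type) (_ : MeasurableSpace Ω) (P : Measure Ω) (_ : IsProbabilityMeasure P)
      (W : H →ₗᵢ[ℝ] Lp ℝ 2 P), ∀ h, P.map (W h) = gaussianReal 0 (‖h‖₊ ^ 2) := by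
  classical
  obtain ⟨w, b, -⟩ := exists_hilbertBasis ℝ H
  let P : Measure (w → ℝ) := Measure.infinitePi fun _ => gaussianReal 0 1
  have hP : IsProbabilityMeasure P := inferInstance
  have hlaw : ∀ i : w, P.map (fun ω => ω i) = gaussianReal 0 1 := fun i =>
    (measurePreserving_eval_infinitePi (fun _ : w => gaussianReal 0 1) i).map_eq
  have hev : ∀ i : w, AEMeasurable (fun ω : w → ℝ => ω i) P := fun i =>
    (measurable_pi_apply i).aemeasurable
  have hgl : ∀ i : w, HasGaussianLaw (fun ω : w → ℝ => ω i) P := fun i =>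
    ⟨by rw [hlaw i]; infer_instance⟩
  have hmem : ∀ i : w, MemLp (fun ω : w → ℝ => ω i) 2 P := fun i => (hgl i).memLp_two
  have hind : iIndepFun (fun (i : w) (ω : w → ℝ) => ω i) P :=
    iIndepFun_infinitePi (P := fun _ : w => gaussianReal 0 1) (X := fun _ x => x)
      (fun _ => measurable_id)
  have hmean : ∀ i : w, ∫ ω, ω i ∂P = 0 := fun i => by
    have := integral_map (μ := P) (φ := fun ω : w → ℝ => ω i) (f := fun x : ℝ => x)
      (hev i) (by fun_prop)
    rw [← this, hlaw, integral_id_gaussianReal]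
  let e : w → Lp ℝ 2 P := fun i => (hmem i).toLp
  have he : Orthonormal ℝ e := by
    rw [orthonormal_iff_ite]
    intro i j
    have h1 : inner ℝ (e i) (e j) = ∫ ω, ω j * ω i ∂P := by
      rw [L2.inner_def]
      refine integral_congr_ae ?_
      filter_upwards [(hmem i).coeFn_toLp, (hmem j).coeFn_toLp] with ω h1 h2
      simp [e, h1, h2]
    rw [h1]
    split_ifs with hij
    · subst hij
      have := variance_id_gaussianReal (μ := 0) (v := 1)
      rw [← hlaw i, variance_map (by fun_prop) (hev i)] at this
      rw [variance_eq_integral (by simpa using hev i)] at this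
      simpa [hmean, sq] using this
    · have := (hind.indepFun (Ne.symm hij)).integral_fun_mul_eq_mul_integral
        (hmem j).aestronglyMeasurable (hmem i).aestronglyMeasurable
      rw [this, hmean, zero_mul]
  let W : H →ₗᵢ[ℝ] Lp ℝ 2 P :=
    he.orthogonalFamily.linearIsometry.comp b.repr.toLinearIsometry
  refine ⟨w → ℝ, inferInstance, P, hP, W, map_eq_gaussianReal_of_charOne W fun h => ?_⟩
  have hsum : HasSum (fun i => b.repr h i • e i) (W h) := by
    have := he.orthogonalFamily.hasSum_linearIsometry (b.repr h)
    simp only [LinearIsometry.toSpanSingleton_apply] at this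
    exact this
  have hfin : ∀ s : Finset w, charOne (∑ i ∈ s, b.repr h i • e i) =
      Complex.exp (-(‖∑ i ∈ s, b.repr h i • e i‖ ^ 2 / 2 : ℝ)) := by
    intro s
    set c : w → ℝ := fun i => b.repr h i
    have hn : ‖∑ i ∈ s, c i • e i‖ ^ 2 = ∑ i ∈ s, c i ^ 2 := by
      rw [← real_inner_self_eq_norm_sq, he.inner_sum]
      simp [sq]
    have hco : ∀ᵐ ω ∂P, (∑ i ∈ s, c i • e i : Lp ℝ 2 P) ω = ∑ i : s, c i * ω i := by
      have h0 := Lp.coeFn_finsetSum s (fun i => c i • e i)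
      have h1 : ∀ᵐ ω ∂P, ∀ i : s, (c i • e i : Lp ℝ 2 P) ω = c i * ω i := by
        refine ae_all_iff.2 fun i => ?_
        filter_upwards [Lp.coeFn_smul (c i) (e i), (hmem i).coeFn_toLp] with ω h1 h2
        rw [h1, Pi.smul_apply, smul_eq_mul]
        simp only [e]
        rw [h2]
      filter_upwards [h0, h1] with ω h0 h1
      rw [h0, Finset.sum_apply, ← Finset.sum_coe_sort]
      exact Finset.sum_congr rfl fun i _ => h1 i
    have hind' := hind.precomp (g := fun i : s => (i : w)) Subtype.val_injective
    have hprod := hind'.integral_fun_prod_comp (𝕜 := ℂ)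
      (f := fun (i : s) (x : ℝ) => Complex.exp ((c i * x : ℝ) * Complex.I))
      (fun i => hev i) (fun i => by fun_prop)
    calc charOne (∑ i ∈ s, c i • e i)
        = ∫ ω, ∏ i : s, Complex.exp ((c i * ω i : ℝ) * Complex.I) ∂P := by
          refine integral_congr_ae ?_
          filter_upwards [hco] with ω hω
          rw [hω, ← Complex.exp_sum, ← Finset.sum_mul]
          push_cast
          rfl
      _ = ∏ i : s, ∫ ω, Complex.exp ((c i * ω i : ℝ) * Complex.I) ∂P := hprod
      _ = ∏ i : s, Complex.exp (-(c i ^ 2 / 2 : ℝ)) := by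
          refine Finset.prod_congr rfl fun i _ => ?_
          have := charFun_gaussianReal (μ := 0) (v := 1) (c i)
          rw [← hlaw i, charFun_apply_real, integral_map (hev i) (by fun_prop)] at this
          push_cast
          rw [this]
          simp
      _ = _ := by
          rw [← Complex.exp_sum, hn, Finset.sum_coe_sort s (fun i => (-(c i ^ 2 / 2 : ℝ) : ℂ))]
          congr 1
          push_cast
          rw [Finset.sum_neg_distrib, Finset.sum_div]
  have l1 := (lipschitzWith_charOne.continuous.tendsto (W h)).comp hsum
  have l2 : Tendsto (fun s : Finset w => Complex.exp (-(‖∑ i ∈ s, b.repr h i • e i‖ ^ 2 / 2 : ℝ)))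
      atTop (𝓝 (Complex.exp (-(‖W h‖ ^ 2 / 2 : ℝ)))) := by
    have hc : Continuous fun Y : Lp ℝ 2 P => Complex.exp (-(‖Y‖ ^ 2 / 2 : ℝ)) := by fun_prop
    exact (hc.tendsto (W h)).comp hsum
  have := tendsto_nhds_unique l1 (l2.congr fun s => (hfin s).symm)
  rw [this, W.norm_map]

/-- Gaussian processes with covariances given by inner products of a Hilbert space. -/
theorem exists_isGaussianProcess {H : Type} [NormedAddCommGroup H] [InnerProductSpace ℝ H]
    [CompleteSpace H] {T : Type*} (f : T → H) :
    ∃ (Ω : Type) (_ : MeasurableSpace Ω) (P : Measure Ω) (_ : IsProbabilityMeasure P)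
      (ξ : T → Ω → ℝ), (∀ t, Measurable (ξ t)) ∧ IsGaussianProcess ξ P ∧
        (∀ t, ∫ ω, ξ t ω ∂P = 0) ∧ ∀ t u, cov[ξ t, ξ u; P] = inner ℝ (f t) (f u) := by
  classical
  obtain ⟨Ω, _, P, _, W, hW⟩ := exists_gaussian_isometry H
  have hm : ∀ h, Measurable (W h) := fun h => (Lp.stronglyMeasurable (W h)).measurable
  have hmean : ∀ h, ∫ ω, W h ω ∂P = 0 := fun h => by
    have := integral_map (μ := P) (φ := W h) (f := fun x : ℝ => x)
      (hm h).aemeasurable (by fun_prop)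
    rw [← this, hW, integral_id_gaussianReal]
  refine ⟨Ω, inferInstance, P, inferInstance, fun t => W (f t), fun t => hm _, ⟨fun I => ⟨?_⟩⟩,
    fun t => hmean _, fun t u => ?_⟩
  · refine isGaussian_of_map_eq_gaussianReal fun L => ?_
    have hmI : Measurable fun ω => I.restrict fun t => W (f t) ω :=
      measurable_pi_lambda _ fun t => hm _
    -- A linear functional of the vector is almost surely the image under `W` of the corresponding
    -- combination in `H`, hence Gaussian.
    refine ⟨0, ‖∑ t : I, L (Pi.single t 1) • f t‖₊ ^ 2, ?_⟩
    rw [← hW, Measure.map_map (by fun_prop) hmI]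
    refine Measure.map_congr ?_
    rw [map_sum]
    have h1 : ∀ᵐ ω ∂P, ∀ t : I, (W (L (Pi.single t 1) • f t)) ω = L (Pi.single t 1) * W (f t) ω := by
      refine ae_all_iff.2 fun t => ?_
      rw [map_smul]
      filter_upwards [Lp.coeFn_smul (L (Pi.single t 1)) (W (f t))] with ω hω
      rw [hω]; simp
    filter_upwards [Lp.coeFn_finsetSum Finset.univ (fun t : I => W (L (Pi.single t 1) • f t)), h1]
      with ω h0 h1
    rw [h0, Finset.sum_apply]
    simp only [h1, Function.comp]
    conv_lhs => rw [← Finset.univ_sum_single (I.restrict fun t => W (f t) ω), map_sum]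
    refine Finset.sum_congr rfl fun t _ => ?_
    have : Pi.single t (I.restrict (fun t => W (f t) ω) t) =
        (W (f t) ω) • (Pi.single t (1 : ℝ) : I → ℝ) := by
      rw [← Pi.single_smul]; simp
    rw [this, map_smul, smul_eq_mul, mul_comm]
  · rw [covariance_eq_sub (Lp.memLp _) (Lp.memLp _), hmean, zero_mul, sub_zero,
      ← W.inner_map_map, L2.inner_def]
    refine integral_congr_ae (ae_of_all _ fun ω => ?_)
    simp [mul_comm]

end Gaussian

/-! ### Convergence of compensated exponents -/

section CompensatedExponent

/-- For `|x| ≤ 1` this is the third-order remainder; beyond, each term is bounded by a multiple of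
`x²`. The minimum lets finite second moments suffice. -/
lemma norm_exp_taylor_le (x : ℝ) :
    ‖Complex.exp (x * Complex.I) - 1 - x * Complex.I + (x ^ 2 / 2 : ℝ)‖ ≤
      3 * (x ^ 2 * min 1 |x|) := by
  rcases le_total |x| 1 with hx | hx
  · rw [min_eq_right hx]
    have h := Complex.exp_bound (x := x * Complex.I) (by simpa using hx) (n := 3) (by norm_num)
    have e : Complex.exp (x * Complex.I) - 1 - x * Complex.I + (x ^ 2 / 2 : ℝ) =
        Complex.exp (x * Complex.I) -
          ∑ m ∈ Finset.range 3, (x * Complex.I) ^ m / (m.factorial : ℂ) := by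
      simp only [Finset.sum_range_succ, Finset.sum_range_zero, Nat.factorial, mul_pow,
        Complex.I_sq]
      push_cast
      ring
    rw [e]
    refine h.trans ?_
    have : ‖(x : ℂ) * Complex.I‖ = |x| := by simp
    rw [this]
    simp only [Nat.factorial]
    have h3 : 0 ≤ |x| ^ 3 := by positivity
    have h5 : x ^ 2 * |x| = |x| ^ 3 := by rw [← sq_abs]; ring
    norm_num
    rw [h5]
    linarith
  · rw [min_eq_left hx, mul_one]
    have h1 : ‖Complex.exp (x * Complex.I) - 1‖ ≤ |x| := by
      have := Real.norm_exp_I_mul_ofReal_sub_one_le (x := x)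
      rwa [mul_comm] at this
    have h2 : ‖(x : ℂ) * Complex.I‖ = |x| := by simp
    have h3 : ‖((x ^ 2 / 2 : ℝ) : ℂ)‖ = x ^ 2 / 2 := by
      rw [Complex.norm_real, Real.norm_of_nonneg (by positivity)]
    have h4 : |x| ≤ x ^ 2 := by rw [← sq_abs]; nlinarith
    calc _ ≤ ‖Complex.exp (x * Complex.I) - 1‖ + ‖(x : ℂ) * Complex.I‖ +
          ‖((x ^ 2 / 2 : ℝ) : ℂ)‖ := (norm_add_le _ _).trans (by gcongr; exact norm_sub_le _ _)
      _ ≤ 3 * x ^ 2 := by rw [h2, h3]; linarith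

/-- If the second moments converge and satisfy a Lindeberg condition, the exponents of the
compensated Poisson characteristic functionals converge to the Gaussian exponent. -/
theorem tendsto_compensated_exponent {α ι : Type*} [MeasurableSpace α] {l : Filter ι}
    {ν : ι → Measure α} {f : ι → α → ℝ} (hf : ∀ i, Measurable (f i))
    (hi : ∀ i, Integrable (fun p => f i p ^ 2) (ν i)) {V : ℝ}
    (hV : Tendsto (fun i => ∫ p, f i p ^ 2 ∂(ν i)) l (𝓝 V))
    (hL : Tendsto (fun i => ∫ p, f i p ^ 2 * min 1 |f i p| ∂(ν i)) l (𝓝 0)) :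
    Tendsto (fun i => ∫ p, (Complex.exp (f i p * Complex.I) - 1 - f i p * Complex.I) ∂(ν i)) l
      (𝓝 (-(V / 2 : ℝ))) := by
  have hiL : ∀ i, Integrable (fun p => f i p ^ 2 * min 1 |f i p|) (ν i) := fun i => by
    have := hf i
    refine (hi i).mono' (by fun_prop) (ae_of_all _ fun p => ?_)
    rw [Real.norm_of_nonneg (by positivity)]
    exact mul_le_of_le_one_right (sq_nonneg _) (min_le_left _ _)
  have hiR : ∀ i, Integrable (fun p => Complex.exp (f i p * Complex.I) - 1 - f i p * Complex.I +
      (f i p ^ 2 / 2 : ℝ)) (ν i) := fun i => by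
    have := hf i
    exact ((hiL i).const_mul 3).mono' (by fun_prop) (ae_of_all _ fun p => norm_exp_taylor_le _)
  have hiS : ∀ i, Integrable (fun p => ((f i p ^ 2 / 2 : ℝ) : ℂ)) (ν i) := fun i =>
    ((hi i).div_const 2).ofReal
  have e : ∀ i, ∫ p, (Complex.exp (f i p * Complex.I) - 1 - f i p * Complex.I) ∂(ν i) =
      (∫ p, (Complex.exp (f i p * Complex.I) - 1 - f i p * Complex.I +
        (f i p ^ 2 / 2 : ℝ)) ∂(ν i)) - (((∫ p, f i p ^ 2 ∂(ν i)) / 2 : ℝ) : ℂ) := fun i => by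
    have h1 : (((∫ p, f i p ^ 2 ∂(ν i)) / 2 : ℝ) : ℂ) = ∫ p, ((f i p ^ 2 / 2 : ℝ) : ℂ) ∂(ν i) := by
      rw [← integral_div]; exact integral_ofReal.symm
    rw [h1, ← integral_sub (hiR i) (hiS i)]
    congr with p
    ring
  simp_rw [e]
  have hR : Tendsto (fun i => ∫ p, (Complex.exp (f i p * Complex.I) - 1 - f i p * Complex.I +
      (f i p ^ 2 / 2 : ℝ)) ∂(ν i)) l (𝓝 0) := by
    refine squeeze_zero_norm (fun i => ?_) (by simpa using hL.const_mul 3)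
    rw [← integral_const_mul]
    exact norm_integral_le_of_norm_le ((hiL i).const_mul 3)
      (ae_of_all _ fun p => norm_exp_taylor_le _)
  have := hR.sub ((Complex.continuous_ofReal.tendsto _).comp (hV.div_const 2))
  simpa using this

end CompensatedExponent

/-! ### Moments of the elementary surfaces near a regular point -/

section LocalMoments

variable {μ : Measure Marked} {Λ : ℝ → Kernel ℝ (ℝ × ℝ)} {z s : ℝ}

lemma integral_jump_sq_mul (ν : Measure Marked) {g : ℝ × ℝ → ℝ≥0} (hg : Continuous g)
    (a b : Plane) : ∫ p, jump a b p ^ 2 * g p.2 ∂ν =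
      (flux ν (fun q => (g q : ℝ≥0∞) * ENNReal.ofReal (q.2 ^ 2)) a b).toReal := by
  have hm : Measurable fun p : Marked => (g p.2 : ℝ) :=
    (NNReal.continuous_coe.comp (hg.comp continuous_snd)).measurable
  rw [integral_eq_lintegral_of_nonneg_ae (ae_of_all _ fun p => by positivity)
      (Measurable.aestronglyMeasurable (by fun_prop)), flux,
    ← lintegral_indicator (measurableSet_sep a b)]
  congr 2
  ext p
  rw [jump_sq]
  by_cases h : p ∈ sep a b
  · simp only [h, Set.indicator_of_mem]
    rw [ENNReal.ofReal_mul (by positivity), ENNReal.ofReal_coe_nnreal, mul_comm]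
  · simp [h]

lemma flux_ne_top {ν : Measure Marked} (hν : IsCrossRegular ν) {g : ℝ × ℝ → ℝ≥0} {C : ℝ≥0}
    (hC : ∀ q, g q ≤ C) (a b : Plane) :
    flux ν (fun q => (g q : ℝ≥0∞) * ENNReal.ofReal (q.2 ^ 2)) a b ≠ ∞ := by
  refine ne_of_lt ?_
  calc flux ν (fun q => (g q : ℝ≥0∞) * ENNReal.ofReal (q.2 ^ 2)) a b
      ≤ ∫⁻ p in sep a b, (C : ℝ≥0∞) * ENNReal.ofReal (p.2.2 ^ 2) ∂ν := by
        exact lintegral_mono fun p => mul_le_mul_left (ENNReal.coe_le_coe.2 (hC _)) _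
    _ = C * secondMoment ν (sep a b) := by
        rw [lintegral_const_mul _ (by fun_prop), secondMoment_apply _ (measurableSet_sep a b)]
    _ < ∞ := by
        rw [← hν.secondMoment_cross]
        exact ENNReal.mul_lt_top ENNReal.coe_lt_top (hν.finite a b)

lemma RegularAt.tendsto_integral_jump_sq_mul [SFinite μ] (hΛ : IsLocalDensity μ Λ)
    (hreg : RegularAt Λ z s) {g : ℝ × ℝ → ℝ≥0} (hg : Continuous g) {C : ℝ≥0}
    (hC : ∀ q, g q ≤ C) (a b : Plane) :
    Tendsto (fun ε : ℝ => ε⁻¹ * ∫ p, jump (ε • a + (z, s)) (ε • b + (z, s)) p ^ 2 * g p.2 ∂μ)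
      (𝓝[>] 0) (𝓝 (∫ p, jump a b p ^ 2 * g p.2 ∂(hatMeasure Λ z s))) := by
  have h := hreg.tendsto_flux hΛ hg hC a b
  have h2 := (ENNReal.tendsto_toReal
    (flux_ne_top (hreg.isCrossRegular_hatMeasure hΛ) hC a b)).comp h
  rw [integral_jump_sq_mul _ hg]
  refine h2.congr' ?_
  filter_upwards [self_mem_nhdsWithin] with ε hε
  rw [Function.comp_apply, ENNReal.toReal_div, ENNReal.toReal_ofReal (le_of_lt hε),
    integral_jump_sq_mul _ hg, div_eq_inv_mul]

lemma RegularAt.tendsto_crossDist [SFinite μ] (hΛ : IsLocalDensity μ Λ) (hM : InM μ)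
    (hreg : RegularAt Λ z s) (a b : Plane) :
    Tendsto (fun ε : ℝ => ε⁻¹ * crossDist μ (ε • a + (z, s)) (ε • b + (z, s))) (𝓝[>] 0)
      (𝓝 (crossDist (hatMeasure Λ z s) a b)) := by
  have h := hreg.tendsto_integral_jump_sq_mul hΛ (g := fun _ => 1) (C := 1) continuous_const
    (fun _ => le_rfl) a b
  simpa [(hΛ.isCrossRegular hM).integral_jump_sq,
    (hreg.isCrossRegular_hatMeasure hΛ).integral_jump_sq] using h

/-- The covariance kernel of the Lévy–Chentsov field of a measure. -/
noncomputable def covKernel (ν : Measure Marked) (a b : Plane) : ℝ :=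
  (crossDist ν 0 a + crossDist ν 0 b - crossDist ν a b) / 2

lemma RegularAt.tendsto_integral_jump_mul_jump [SFinite μ] (hΛ : IsLocalDensity μ Λ) (hM : InM μ)
    (hreg : RegularAt Λ z s) (a b : Plane) :
    Tendsto (fun ε : ℝ => ε⁻¹ * ∫ p, jump (z, s) (ε • a + (z, s)) p *
      jump (z, s) (ε • b + (z, s)) p ∂μ) (𝓝[>] 0) (𝓝 (covKernel (hatMeasure Λ z s) a b)) := by
  have h := (((hreg.tendsto_crossDist hΛ hM 0 a).add (hreg.tendsto_crossDist hΛ hM 0 b)).sub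
    (hreg.tendsto_crossDist hΛ hM a b)).div_const 2
  refine h.congr fun ε => ?_
  rw [(hΛ.isCrossRegular hM).integral_jump_mul_jump]
  simp only [smul_zero, zero_add]
  ring

lemma integral_jump_mul_jump_eq_covKernel (hΛ : IsLocalDensity μ Λ) (hM : InM μ) (a b : Plane) :
    ∫ p, jump (z, s) (a + (z, s)) p * jump (z, s) (b + (z, s)) p ∂μ =
      covKernel (tildeMeasure Λ z s) a b := by
  rw [(hΛ.isCrossRegular hM).integral_jump_mul_jump, covKernel]
  simp only [hΛ.crossDist_tildeMeasure, zero_add]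

lemma abs_jump_le (c a : Plane) (p : Marked) : |jump c a p| ≤ |p.2.2| := by
  rw [abs_jump]
  exact Set.indicator_le_self' (fun _ _ => abs_nonneg _) p

/-- A nonzero jump has absolute value `|r|`, and any other jump is at most that. For mixed
covariances this beats Cauchy–Schwarz: it yields a bound of order `ε` instead of `√ε`, which the
weight `ε^{-1/2}` would not let vanish. -/
lemma abs_jump_mul_jump_le (c a d b : Plane) (p : Marked) :
    |jump c a p * jump d b p| ≤ jump c a p ^ 2 := by
  rw [abs_mul, jump_sq, abs_jump]
  by_cases h : p ∈ sep c a
  · simp only [h, Set.indicator_of_mem]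
    rw [← sq_abs, sq]
    exact mul_le_mul_of_nonneg_left (abs_jump_le d b p) (abs_nonneg _)
  · simp [h]

lemma IsCrossRegular.abs_integral_jump_mul_jump_le {ν : Measure Marked} (hν : IsCrossRegular ν)
    (c a d b : Plane) : |∫ p, jump c a p * jump d b p ∂ν| ≤ crossDist ν c a := by
  rw [← hν.integral_jump_sq]
  exact norm_integral_le_of_norm_le (f := fun p => jump c a p * jump d b p)
    (hν.integrable_jump_sq c a) (ae_of_all _ fun p => abs_jump_mul_jump_le c a d b p)

lemma integrable_jump_sq_mul_min {ν : Measure Marked} (hν : IsCrossRegular ν) (c a : Plane)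
    (δ : ℝ) (hδ : 0 ≤ δ) : Integrable (fun p => jump c a p ^ 2 * min 1 (δ * |p.2.2|)) ν := by
  refine (hν.integrable_jump_sq c a).mono' (Measurable.aestronglyMeasurable (by fun_prop))
    (ae_of_all _ fun p => ?_)
  rw [Real.norm_of_nonneg (by positivity)]
  exact mul_le_of_le_one_right (sq_nonneg _) (min_le_left _ _)

lemma IsCrossRegular.tendsto_integral_jump_sq_mul_min {ν : Measure Marked}
    (hν : IsCrossRegular ν) (c a : Plane) :
    Tendsto (fun δ : ℝ => ∫ p, jump c a p ^ 2 * min 1 (δ * |p.2.2|) ∂ν) (𝓝[>] 0) (𝓝 0) := by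
  have h0 : ∫ p, jump c a p ^ 2 * min 1 (0 * |p.2.2|) ∂ν = 0 := by simp
  suffices h : Tendsto (fun δ : ℝ => ∫ p, jump c a p ^ 2 * min 1 (δ * |p.2.2|) ∂ν) (𝓝[>] 0)
      (𝓝 (∫ p, jump c a p ^ 2 * min 1 (0 * |p.2.2|) ∂ν)) by rwa [h0] at h
  refine tendsto_integral_filter_of_dominated_convergence (fun p => jump c a p ^ 2)
    (Eventually.of_forall fun δ => Measurable.aestronglyMeasurable (by fun_prop)) ?_
    (hν.integrable_jump_sq c a) (ae_of_all _ fun p => ?_)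
  · filter_upwards [self_mem_nhdsWithin] with δ hδ
    have hδ : 0 < δ := hδ
    refine ae_of_all _ fun p => ?_
    rw [Real.norm_of_nonneg (by positivity)]
    exact mul_le_of_le_one_right (sq_nonneg _) (min_le_left _ _)
  · have : Continuous fun δ : ℝ => jump c a p ^ 2 * min 1 (δ * |p.2.2|) := by fun_prop
    exact (this.tendsto 0).mono_left nhdsWithin_le_nhds

/-- The Lindeberg condition for the surfaces near a regular point. -/
lemma RegularAt.tendsto_lindeberg [SFinite μ] (hΛ : IsLocalDensity μ Λ) (hM : InM μ)
    (hreg : RegularAt Λ z s) (a : Plane) {δ : ℝ → ℝ} (hδ : Tendsto δ (𝓝[>] 0) (𝓝 0))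
    (hδ0 : ∀ ε, 0 < ε → 0 ≤ δ ε) :
    Tendsto (fun ε : ℝ => ε⁻¹ * ∫ p, jump (z, s) (ε • a + (z, s)) p ^ 2 *
      min 1 (δ ε * |p.2.2|) ∂μ) (𝓝[>] 0) (𝓝 0) := by
  have hcr := hΛ.isCrossRegular hM
  have hhat := (hreg.isCrossRegular_hatMeasure hΛ).tendsto_integral_jump_sq_mul_min 0 a
  rw [Metric.tendsto_nhds]
  intro τ hτ
  -- The truncation level is frozen at `η`, chosen so that the limiting integral is below `τ`. Once
  -- `δ ε < η`, monotonicity reduces to a fixed bounded continuous weight, to which the local limit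
  -- applies.
  obtain ⟨η, hη, hη0⟩ := ((hhat.eventually_lt_const hτ).and self_mem_nhdsWithin).exists
  have hη0 : 0 < η := hη0
  let g : ℝ × ℝ → ℝ≥0 := fun q => min 1 (η.toNNReal * ‖q.2‖₊)
  have hgc : Continuous g := by fun_prop
  have hg : ∀ q, ((g q : ℝ≥0) : ℝ) = min 1 (η * |q.2|) := fun q => by
    simp [g, hη0.le]
  have hlim := hreg.tendsto_integral_jump_sq_mul hΛ hgc (C := 1) (fun q => min_le_left _ _) 0 a
  simp only [hg, smul_zero, zero_add] at hlim
  filter_upwards [hlim.eventually_lt_const hη, hδ.eventually_lt_const hη0, self_mem_nhdsWithin]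
    with ε h1 h2 hε
  have hε : 0 < ε := hε
  have hnn : 0 ≤ ∫ p, jump (z, s) (ε • a + (z, s)) p ^ 2 * min 1 (δ ε * |p.2.2|) ∂μ :=
    integral_nonneg fun p => by have := hδ0 ε hε; positivity
  rw [Real.dist_0_eq_abs, abs_of_nonneg (by positivity)]
  refine lt_of_le_of_lt ?_ h1
  gcongr ε⁻¹ * ?_
  refine integral_mono (integrable_jump_sq_mul_min hcr _ _ _ (hδ0 ε hε))
    (integrable_jump_sq_mul_min hcr _ _ _ hη0.le) fun p => ?_
  dsimp only
  gcongr

end LocalMoments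

/-! ### The fluctuation fields as compensated Poisson integrals -/

section Fields

lemma InM.measure_sep_lt_top {μ : Measure Marked} (hM : InM μ) (a b : Plane) : μ (sep a b) < ∞ :=
  (measure_mono (sep_subset_cross a b)).trans_lt (lt_of_le_of_lt le_self_add (hM a b))

/-- On a set of finite measure, `|r| ≤ 1 + r²` suffices. -/
lemma IsCrossRegular.integrable_jump {ν : Measure Marked} (hν : IsCrossRegular ν) {c a : Plane}
    (hfin : ν (sep c a) < ∞) : Integrable (jump c a) ν := by
  have h1 : Integrable ((sep c a).indicator fun _ => (1 : ℝ)) ν :=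
    (integrable_indicator_iff (measurableSet_sep c a)).2 (integrableOn_const hfin.ne)
  refine (h1.add (hν.integrable_jump_sq c a)).mono' (measurable_jump c a).aestronglyMeasurable
    (ae_of_all _ fun p => ?_)
  rw [Real.norm_eq_abs, abs_jump, Pi.add_apply, jump_sq]
  by_cases h : p ∈ sep c a
  · simp only [h, Set.indicator_of_mem]
    rw [← sq_abs]
    nlinarith [sq_nonneg (|p.2.2| - 1), abs_nonneg p.2.2]
  · simp [h]

lemma jump_eq_zero {c a : Plane} {p : Marked} (h : p ∉ sep c a) : jump c a p = 0 := by
  rw [← abs_eq_zero, abs_jump, Set.indicator_of_notMem h]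

lemma relHeight_eq_integral {m : Measure Marked} {z s : ℝ} {b : Plane}
    (h1 : Integrable (jump 0 (b + (z, s))) m) (h2 : Integrable (jump 0 (z, s)) m) :
    relHeight m z s b = ∫ p, jump (z, s) (b + (z, s)) p ∂m := by
  rw [relHeight, height, height, step_eq_jump, step_eq_jump, ← integral_sub h1 h2]
  congr with p
  exact jump_sub_jump _ _ _ _

lemma relHeight_scaledEmpirical {e : ℝ} (he : 0 ≤ e) (X : Set Marked) (z s : ℝ) (b : Plane) :
    relHeight (scaledEmpirical e X) z s b = e * relHeight (empirical X) z s b := by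
  simp only [relHeight, height, scaledEmpirical, integral_smul_measure, ENNReal.toReal_ofReal he,
    smul_eq_mul]
  ring

/-- The pair of fluctuation fields, indexed by two copies of the plane. -/
noncomputable def fluctuation (μ : Measure Marked) (z s ε : ℝ) (X : Set Marked) :
    Plane ⊕ Plane → ℝ :=
  Sum.elim (microField μ z s ε X) (macroField μ z s ε X)

/-- The space-time points at which the fluctuation fields are evaluated. -/
def site (z s ε : ℝ) : Plane ⊕ Plane → Plane :=
  Sum.elim (fun a => ε • a + (z, s)) (fun b => b + (z, s))

/-- The relative normalization of the two fluctuation fields. -/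
noncomputable def weight (ε : ℝ) : Plane ⊕ Plane → ℝ :=
  Sum.elim (fun _ => ε ^ (-(1 / 2) : ℝ)) (fun _ => 1)

/-- The intensity measure of the Poisson process at scale `ε²`. -/
noncomputable def intensity (μ : Measure Marked) (ε : ℝ) : Measure Marked :=
  ENNReal.ofReal (ε ^ 2)⁻¹ • μ

lemma integral_intensity (μ : Measure Marked) (ε : ℝ) {E : Type*} [NormedAddCommGroup E]
    [NormedSpace ℝ E] (f : Marked → E) :
    ∫ p, f p ∂(intensity μ ε) = (ε ^ 2)⁻¹ • ∫ p, f p ∂μ := by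
  rw [intensity, integral_smul_measure, ENNReal.toReal_ofReal (by positivity)]

/-- The point mass `ε²` times the normalization `ε⁻¹` leaves `ε`, and centering by `μ` is
compensation by `ε⁻² μ`. Integrability from the origin is needed because heights are defined as
separate integrals before being subtracted. -/
lemma fluctuation_eq {μ : Measure Marked} {z s ε : ℝ} (hε : 0 < ε) {X : Set Marked}
    (hμ : ∀ a, Integrable (jump 0 a) μ) {k : Plane ⊕ Plane}
    (hX : Integrable (jump 0 (site z s ε k)) (empirical X))
    (hX' : Integrable (jump 0 (z, s)) (empirical X)) :
    fluctuation μ z s ε X k = ε * weight ε k *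
      (∫ p, jump (z, s) (site z s ε k) p ∂(empirical X) -
        ∫ p, jump (z, s) (site z s ε k) p ∂(intensity μ ε)) := by
  rw [integral_intensity, smul_eq_mul]
  rcases k with a | b
  · simp only [fluctuation, weight, site, Sum.elim_inl, microField] at hX ⊢
    rw [relHeight_scaledEmpirical (by positivity), relHeight_eq_integral hX hX',
      relHeight_eq_integral (hμ _) (hμ _)]
    field_simp
  · simp only [fluctuation, weight, site, Sum.elim_inr, macroField] at hX ⊢
    rw [relHeight_scaledEmpirical (by positivity), relHeight_eq_integral hX hX',
      relHeight_eq_integral (hμ _) (hμ _)]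
    field_simp

variable {Ω : Type*} [MeasurableSpace Ω] {P : Measure Ω}
  {X : Ω → Set Marked} {μ ν : Measure Marked} {z s ε : ℝ}

lemma IsPoissonProcess.measurable_relHeight (hX : IsPoissonProcess P X ν) (e : ℝ) (he : 0 ≤ e)
    (b : Plane) : Measurable fun ω => relHeight (scaledEmpirical e (X ω)) z s b := by
  simp only [relHeight_scaledEmpirical he]
  simp only [relHeight, height, step_eq_jump]
  exact ((hX.measurable_integral (measurable_jump _ _)).sub
    (hX.measurable_integral (measurable_jump _ _))).const_mul e

lemma IsPoissonProcess.measurable_fluctuation (hX : IsPoissonProcess P X ν)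
    (k : Plane ⊕ Plane) : Measurable fun ω => fluctuation μ z s ε (X ω) k := by
  rcases k with a | b
  · simp only [fluctuation, Sum.elim_inl, microField]
    exact ((hX.measurable_relHeight _ (sq_nonneg ε) _).sub_const _).const_mul _
  · simp only [fluctuation, Sum.elim_inr, macroField]
    exact ((hX.measurable_relHeight _ (sq_nonneg ε) _).sub_const _).const_mul _

/-- The integrand of a linear combination of the fluctuation fields. -/
noncomputable def integrand {K : Type*} [Fintype K] (z s ε : ℝ) (κ : K → Plane ⊕ Plane)
    (t : K → ℝ) (p : Marked) : ℝ :=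
  ε * ∑ k, t k * (weight ε (κ k) * jump (z, s) (site z s ε (κ k)) p)

@[fun_prop]
lemma measurable_integrand {K : Type*} [Fintype K] (z s ε : ℝ) (κ : K → Plane ⊕ Plane)
    (t : K → ℝ) : Measurable (integrand z s ε κ t) := by
  unfold integrand
  exact (Finset.measurable_fun_sum _ fun k _ =>
    ((measurable_jump _ _).const_mul _).const_mul _).const_mul _

/-- The characteristic function of the fluctuation fields. -/
theorem IsPoissonProcess.charFun_fluctuation [IsProbabilityMeasure P]
    (hX : IsPoissonProcess P X (intensity μ ε)) (hε : 0 < ε) (hμ : IsCrossRegular μ) (hM : InM μ)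
    {K : Type*} [Fintype K] (κ : K → Plane ⊕ Plane) (t : K → ℝ) :
    ∫ ω, Complex.exp ((∑ k, t k * fluctuation μ z s ε (X ω) (κ k) : ℝ) * Complex.I) ∂P =
      Complex.exp (∫ p, (Complex.exp (integrand z s ε κ t p * Complex.I) - 1 -
        integrand z s ε κ t p * Complex.I) ∂(intensity μ ε)) := by
  have hfin : ∀ a b, intensity μ ε (sep a b) < ∞ := fun a b => by
    rw [intensity, Measure.smul_apply, smul_eq_mul]
    exact ENNReal.mul_lt_top ENNReal.ofReal_lt_top (hM.measure_sep_lt_top a b)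
  have hμi : ∀ c a, Integrable (jump c a) μ := fun c a =>
    hμ.integrable_jump (hM.measure_sep_lt_top c a)
  have hνi : ∀ c a, Integrable (jump c a) (intensity μ ε) := fun c a =>
    (hμi c a).smul_measure ENNReal.ofReal_ne_top
  have hXi : ∀ c a, ∀ᵐ ω ∂P, Integrable (jump c a) (empirical (X ω)) := fun c a => by
    filter_upwards [hX.ae_lt_top (measurableSet_sep c a) (hfin c a)] with ω hω
    exact integrable_empirical (measurableSet_sep c a) hω.ne (measurable_jump c a)
      fun p hp => jump_eq_zero hp
  set S : Set Marked := ⋃ k, sep (z, s) (site z s ε (κ k)) with hS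
  have hSm : MeasurableSet S := MeasurableSet.iUnion fun k => measurableSet_sep _ _
  have hSfin : intensity μ ε S < ∞ :=
    (measure_iUnion_fintype_le _ _).trans_lt (ENNReal.sum_lt_top.2 fun k _ => hfin _ _)
  have hfS : ∀ p ∉ S, integrand z s ε κ t p = 0 := fun p hp => by
    have : ∀ k, jump (z, s) (site z s ε (κ k)) p = 0 := fun k =>
      jump_eq_zero fun h => hp (Set.mem_iUnion.2 ⟨k, h⟩)
    simp [integrand, this]
  have hint : ∀ m : Measure Marked, (∀ k, Integrable (jump (z, s) (site z s ε (κ k))) m) →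
      ∫ p, integrand z s ε κ t p ∂m =
        ∑ k, t k * (ε * weight ε (κ k) * ∫ p, jump (z, s) (site z s ε (κ k)) p ∂m) := by
    intro m hm
    simp only [integrand]
    rw [integral_const_mul, integral_finsetSum _ fun k _ => ((hm k).const_mul _).const_mul _,
      Finset.mul_sum]
    refine Finset.sum_congr rfl fun k _ => ?_
    rw [integral_const_mul, integral_const_mul]
    ring
  have hfi : Integrable (integrand z s ε κ t) (intensity μ ε) := by
    unfold integrand
    exact (integrable_finsetSum _ fun k _ => ((hνi _ _).const_mul _).const_mul _).const_mul _
  rw [← hX.charFun_compensated hSm hSfin (measurable_integrand z s ε κ t) hfS hfi]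
  refine integral_congr_ae ?_
  filter_upwards [ae_all_iff.2 fun k => hXi 0 (site z s ε (κ k)), hXi 0 (z, s),
    ae_all_iff.2 fun k => hXi (z, s) (site z s ε (κ k))] with ω h1 h2 h3
  rw [hint _ h3, hint _ fun k => hνi _ _, ← Finset.sum_sub_distrib]
  congr 3
  refine Finset.sum_congr rfl fun k _ => ?_
  rw [fluctuation_eq hε (hμi 0) (h1 k) h2]
  ring

end Fields

/-! ### Convergence of the characteristic functions -/

section Convergence

variable {μ : Measure Marked} {Λ : ℝ → Kernel ℝ (ℝ × ℝ)} {z s : ℝ}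

/-- The covariances of the pair of limit fields. -/
noncomputable def limitCov (Λ : ℝ → Kernel ℝ (ℝ × ℝ)) (z s : ℝ) :
    Plane ⊕ Plane → Plane ⊕ Plane → ℝ
  | .inl a, .inl b => covKernel (hatMeasure Λ z s) a b
  | .inr a, .inr b => covKernel (tildeMeasure Λ z s) a b
  | _, _ => 0

lemma rpow_neg_half_mul_self {ε : ℝ} (hε : 0 < ε) :
    ε ^ (-(1 / 2) : ℝ) * ε ^ (-(1 / 2) : ℝ) = ε⁻¹ := by
  rw [← Real.rpow_add hε, ← Real.rpow_neg_one]
  norm_num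

lemma self_mul_rpow_neg_half {ε : ℝ} (hε : 0 < ε) : ε * ε ^ (-(1 / 2) : ℝ) = √ε := by
  rw [Real.sqrt_eq_rpow]
  nth_rewrite 1 [← Real.rpow_one ε]
  rw [← Real.rpow_add hε]
  norm_num

lemma tendsto_sqrt_zero : Tendsto (fun ε : ℝ => √ε) (𝓝[>] 0) (𝓝 0) := by
  have := (Real.continuous_sqrt.tendsto 0).mono_left (nhdsWithin_le_nhds (s := Set.Ioi 0))
  rwa [Real.sqrt_zero] at this

lemma RegularAt.tendsto_gram [SFinite μ] (hΛ : IsLocalDensity μ Λ) (hM : InM μ)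
    (hreg : RegularAt Λ z s) (k l : Plane ⊕ Plane) :
    Tendsto (fun ε : ℝ => weight ε k * weight ε l *
      ∫ p, jump (z, s) (site z s ε k) p * jump (z, s) (site z s ε l) p ∂μ) (𝓝[>] 0)
      (𝓝 (limitCov Λ z s k l)) := by
  have hcr := hΛ.isCrossRegular hM
  -- The bound is `ε^{-1/2}` times the microscopic distance, that is `√ε` times a convergent
  -- quantity.
  have hmixed : ∀ a b : Plane, Tendsto (fun ε : ℝ => ε ^ (-(1 / 2) : ℝ) *
      ∫ p, jump (z, s) (ε • a + (z, s)) p * jump (z, s) (b + (z, s)) p ∂μ) (𝓝[>] 0) (𝓝 0) := by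
    intro a b
    have h1 := tendsto_sqrt_zero.mul (hreg.tendsto_crossDist hΛ hM 0 a)
    rw [zero_mul] at h1
    refine squeeze_zero_norm' ?_ h1
    filter_upwards [self_mem_nhdsWithin] with ε hε
    have hε : 0 < ε := hε
    rw [norm_mul, Real.norm_of_nonneg (by positivity), smul_zero, zero_add, ← mul_assoc,
      ← self_mul_rpow_neg_half hε, mul_comm ε, mul_assoc (ε ^ (-(1 / 2) : ℝ)),
      mul_inv_cancel₀ hε.ne', mul_one]
    gcongr
    exact hcr.abs_integral_jump_mul_jump_le _ _ _ _
  rcases k with a | a <;> rcases l with b | b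
  · refine (hreg.tendsto_integral_jump_mul_jump hΛ hM a b).congr' ?_
    filter_upwards [self_mem_nhdsWithin] with ε hε
    simp only [weight, site, Sum.elim_inl]
    rw [rpow_neg_half_mul_self hε]
  · simpa [weight, site, limitCov] using hmixed a b
  · simpa [weight, site, limitCov, mul_comm] using hmixed b a
  · simp only [weight, site, Sum.elim_inr, limitCov]
    rw [← integral_jump_mul_jump_eq_covKernel hΛ hM]
    simp

lemma RegularAt.tendsto_weighted_lindeberg [SFinite μ] (hΛ : IsLocalDensity μ Λ) (hM : InM μ)
    (hreg : RegularAt Λ z s) (k : Plane ⊕ Plane) {δ : ℝ → ℝ} (hδ : Tendsto δ (𝓝[>] 0) (𝓝 0))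
    (hδ0 : ∀ ε, 0 < ε → 0 < δ ε) :
    Tendsto (fun ε : ℝ => weight ε k ^ 2 *
      ∫ p, jump (z, s) (site z s ε k) p ^ 2 * min 1 (δ ε * |p.2.2|) ∂μ) (𝓝[>] 0) (𝓝 0) := by
  rcases k with a | b
  · refine (hreg.tendsto_lindeberg hΛ hM a hδ fun ε hε => (hδ0 ε hε).le).congr' ?_
    filter_upwards [self_mem_nhdsWithin] with ε hε
    simp only [weight, site, Sum.elim_inl]
    rw [sq, rpow_neg_half_mul_self hε]
  · have h : Tendsto δ (𝓝[>] 0) (𝓝[>] 0) :=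
      tendsto_nhdsWithin_iff.2 ⟨hδ, by filter_upwards [self_mem_nhdsWithin] with ε hε using hδ0 ε hε⟩
    simpa [weight, site, Function.comp_def] using
      ((hΛ.isCrossRegular hM).tendsto_integral_jump_sq_mul_min (z, s) (b + (z, s))).comp h

/-- The exponents of the characteristic functions converge. -/
theorem RegularAt.tendsto_exponent [SFinite μ] (hΛ : IsLocalDensity μ Λ) (hM : InM μ)
    (hreg : RegularAt Λ z s) {K : Type*} [Fintype K] (κ : K → Plane ⊕ Plane) (t : K → ℝ) :
    Tendsto (fun ε : ℝ => ∫ p, (Complex.exp (integrand z s ε κ t p * Complex.I) - 1 -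
        integrand z s ε κ t p * Complex.I) ∂(intensity μ ε)) (𝓝[>] 0)
      (𝓝 (-((∑ k, ∑ l, t k * t l * limitCov Λ z s (κ k) (κ l)) / 2 : ℝ))) := by
  have hcr := hΛ.isCrossRegular hM
  let Y : ℝ → K → Marked → ℝ := fun ε k p => weight ε (κ k) * jump (z, s) (site z s ε (κ k)) p
  have hYm : ∀ ε k, MemLp (Y ε k) 2 μ := fun ε k => (hcr.memLp_jump _ _).const_mul _
  have hfm : ∀ ε, MemLp (integrand z s ε κ t) 2 μ := fun ε => by
    unfold integrand
    exact (memLp_finsetSum _ fun k _ => (hYm ε k).const_mul _).const_mul _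
  have hsq : ∀ ε p, integrand z s ε κ t p ^ 2 =
      ε ^ 2 * ∑ k, ∑ l, t k * t l * (weight ε (κ k) * weight ε (κ l)) *
        (jump (z, s) (site z s ε (κ k)) p * jump (z, s) (site z s ε (κ l)) p) := fun ε p => by
    rw [integrand, mul_pow, sq (∑ k, _), Finset.sum_mul_sum]
    congr 1
    refine Finset.sum_congr rfl fun k _ => Finset.sum_congr rfl fun l _ => ?_
    ring
  refine tendsto_compensated_exponent (ν := intensity μ) (fun ε => measurable_integrand z s ε κ t)
    (fun ε => (hfm ε).integrable_sq.smul_measure ENNReal.ofReal_ne_top) ?_ ?_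
  · have hlim := tendsto_finsetSum Finset.univ fun k _ => tendsto_finsetSum Finset.univ fun l _ =>
      (hreg.tendsto_gram hΛ hM (κ k) (κ l)).const_mul (t k * t l)
    refine hlim.congr' ?_
    filter_upwards [self_mem_nhdsWithin] with ε hε
    have hε : 0 < ε := hε
    rw [integral_intensity]
    simp_rw [hsq]
    rw [integral_const_mul, smul_eq_mul, inv_mul_cancel_left₀ (by positivity), integral_finsetSum]
    · refine Finset.sum_congr rfl fun k _ => ?_
      rw [integral_finsetSum]
      · refine Finset.sum_congr rfl fun l _ => ?_
        rw [integral_const_mul, mul_assoc (t k * t l)]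
      · exact fun l _ => (hcr.integrable_jump_mul_jump _ _ _ _).const_mul _
    · exact fun k _ => integrable_finsetSum _ fun l _ =>
        (hcr.integrable_jump_mul_jump _ _ _ _).const_mul _
  -- The integrand is at most `δ ε |r|`, since both `ε · ε^{-1/2} = √ε` and `ε` are at most `√ε +
  -- ε`. The summand `1` only makes `T` positive.
  · set T : ℝ := 1 + ∑ k, |t k| with hT
    have hT0 : 0 < T := by positivity
    let δ : ℝ → ℝ := fun ε => (√ε + ε) * T
    have hδ : Tendsto δ (𝓝[>] 0) (𝓝 0) := by
      have h1 : Tendsto (fun ε : ℝ => ε) (𝓝[>] 0) (𝓝 0) := nhdsWithin_le_nhds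
      simpa using (tendsto_sqrt_zero.add h1).mul_const T
    have hδ0 : ∀ ε, 0 < ε → 0 < δ ε := fun ε hε => by
      have := Real.sqrt_nonneg ε
      simp only [δ]; positivity
    have hbound := tendsto_finsetSum Finset.univ fun k _ =>
      (hreg.tendsto_weighted_lindeberg hΛ hM (κ k) hδ hδ0).const_mul
        ((Fintype.card K : ℝ) * t k ^ 2)
    simp only [mul_zero, Finset.sum_const_zero] at hbound
    refine squeeze_zero' (Eventually.of_forall fun ε => integral_nonneg fun p => by positivity) ?_
      hbound
    filter_upwards [self_mem_nhdsWithin] with ε hε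
    have hε : 0 < ε := hε
    have hw : ∀ k, ε * weight ε k ≤ √ε + ε := by
      rintro (a | b)
      · simp only [weight, Sum.elim_inl, self_mul_rpow_neg_half hε]; linarith
      · simp only [weight, Sum.elim_inr, mul_one]; linarith [Real.sqrt_nonneg ε]
    have hw0 : ∀ k, 0 ≤ weight ε k := by
      rintro (a | b)
      · simp only [weight, Sum.elim_inl]; positivity
      · simp [weight]
    have habs : ∀ p, |integrand z s ε κ t p| ≤ δ ε * |p.2.2| := fun p => by
      calc |integrand z s ε κ t p|
          = ε * |∑ k, t k * (weight ε (κ k) * jump (z, s) (site z s ε (κ k)) p)| := by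
            rw [integrand, abs_mul, abs_of_pos hε]
        _ ≤ ε * ∑ k, |t k| * (weight ε (κ k) * |p.2.2|) := by
            gcongr
            refine (Finset.abs_sum_le_sum_abs _ _).trans (Finset.sum_le_sum fun k _ => ?_)
            rw [abs_mul, abs_mul, abs_of_nonneg (hw0 _)]
            exact mul_le_mul_of_nonneg_left
              (mul_le_mul_of_nonneg_left (abs_jump_le _ _ _) (hw0 _)) (abs_nonneg _)
        _ = ∑ k, |t k| * ((ε * weight ε (κ k)) * |p.2.2|) := by
            rw [Finset.mul_sum]
            exact Finset.sum_congr rfl fun k _ => by ring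
        _ ≤ ∑ k, |t k| * ((√ε + ε) * |p.2.2|) := by
            refine Finset.sum_le_sum fun k _ => ?_
            gcongr
            exact hw _
        _ = (√ε + ε) * |p.2.2| * ∑ k, |t k| := by
            rw [← Finset.sum_mul, mul_comm]
        _ ≤ (√ε + ε) * |p.2.2| * T := by
            have := Real.sqrt_nonneg ε
            gcongr
            rw [hT]; linarith
        _ = δ ε * |p.2.2| := by simp only [δ]; ring
    have hpt : ∀ p, integrand z s ε κ t p ^ 2 * min 1 |integrand z s ε κ t p| ≤
        ε ^ 2 * ∑ k, (Fintype.card K : ℝ) * t k ^ 2 * (weight ε (κ k) ^ 2 *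
          (jump (z, s) (site z s ε (κ k)) p ^ 2 * min 1 (δ ε * |p.2.2|))) := fun p => by
      -- Cauchy–Schwarz for the finite sum reduces the Lindeberg condition to the individual jumps,
      -- at the cost of the number of terms.
      have h1 : integrand z s ε κ t p ^ 2 ≤ ε ^ 2 * ((Fintype.card K : ℝ) *
          ∑ k, (t k * (weight ε (κ k) * jump (z, s) (site z s ε (κ k)) p)) ^ 2) := by
        rw [integrand, mul_pow]
        gcongr
        exact sq_sum_le_card_mul_sum_sq
      have h2 : min 1 |integrand z s ε κ t p| ≤ min 1 (δ ε * |p.2.2|) := by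
        gcongr
        exact habs p
      have h0 := (hδ0 ε hε).le
      refine (mul_le_mul h1 h2 (by positivity) (by positivity)).trans_eq ?_
      rw [mul_assoc, mul_assoc, Finset.sum_mul, Finset.mul_sum]
      refine congrArg _ (Finset.sum_congr rfl fun k _ => ?_)
      ring
    rw [integral_intensity, smul_eq_mul, inv_mul_le_iff₀ (by positivity)]
    have hji : ∀ k, Integrable (fun p => (Fintype.card K : ℝ) * t k ^ 2 * (weight ε (κ k) ^ 2 *
          (jump (z, s) (site z s ε (κ k)) p ^ 2 * min 1 (δ ε * |p.2.2|)))) μ := fun k =>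
      ((integrable_jump_sq_mul_min hcr _ _ _ (hδ0 ε hε).le).const_mul _).const_mul _
    calc _ ≤ ∫ p, ε ^ 2 * ∑ k, (Fintype.card K : ℝ) * t k ^ 2 * (weight ε (κ k) ^ 2 *
          (jump (z, s) (site z s ε (κ k)) p ^ 2 * min 1 (δ ε * |p.2.2|))) ∂μ := by
          refine integral_mono_of_nonneg (ae_of_all _ fun p => by positivity)
            ((integrable_finsetSum _ fun k _ => hji k).const_mul _) (ae_of_all _ hpt)
      _ = _ := by
          rw [integral_const_mul, integral_finsetSum _ fun k _ => hji k]
          congr 1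
          refine Finset.sum_congr rfl fun k _ => ?_
          rw [integral_const_mul, integral_const_mul]

end Convergence

/-! ### The limit fields -/

section Limit

/-- A family of square integrable functions seen as vectors of the sum of two spaces of square
integrable functions. -/
noncomputable def jumpVector {ν₁ ν₂ : Measure Marked} (h₁ : IsCrossRegular ν₁)
    (h₂ : IsCrossRegular ν₂) : Plane ⊕ Plane → WithLp 2 (Lp ℝ 2 ν₁ × Lp ℝ 2 ν₂) :=
  Sum.elim (fun a => WithLp.toLp 2 ((h₁.memLp_jump 0 a).toLp, 0))
    (fun b => WithLp.toLp 2 (0, (h₂.memLp_jump 0 b).toLp))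

lemma IsCrossRegular.inner_toLp_jump {ν : Measure Marked} (hν : IsCrossRegular ν) (a b : Plane) :
    inner ℝ (hν.memLp_jump 0 a).toLp (hν.memLp_jump 0 b).toLp = covKernel ν a b := by
  rw [covKernel, ← hν.integral_jump_mul_jump, L2.inner_def]
  refine integral_congr_ae ?_
  filter_upwards [(hν.memLp_jump 0 a).coeFn_toLp, (hν.memLp_jump 0 b).coeFn_toLp] with p h1 h2
  rw [h1, h2]
  simp [mul_comm]

lemma isLevyChentsov_of_covariance {Ω : Type*} [MeasurableSpace Ω] {P : Measure Ω}
    {η : Plane → Ω → ℝ} {ν : Measure Marked} (h1 : IsGaussianProcess η P)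
    (h2 : ∀ a, ∫ ω, η a ω ∂P = 0) (h3 : ∀ a b, cov[η a, η b; P] = covKernel ν a b) :
    IsLevyChentsov P η (crossDist ν) :=
  ⟨h1, h2, h3⟩

/-- The characteristic function of a linear combination of a centered Gaussian process. -/
lemma charFun_gaussianProcess {Ω T K : Type*} [MeasurableSpace Ω] {P : Measure Ω}
    [IsProbabilityMeasure P] [Fintype K] {ξ : T → Ω → ℝ} (hξ : IsGaussianProcess ξ P)
    (hmean : ∀ t, ∫ ω, ξ t ω ∂P = 0) (κ : K → T) (t : K → ℝ) :
    ∫ ω, Complex.exp ((∑ k, t k * ξ (κ k) ω : ℝ) * Complex.I) ∂P =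
      Complex.exp (-((∑ k, ∑ l, t k * t l * cov[ξ (κ k), ξ (κ l); P]) / 2 : ℝ)) := by
  have hG : HasGaussianLaw (fun ω => ∑ k, t k * ξ (κ k) ω) P :=
    ((hξ.comp_right κ).smul t).hasGaussianLaw_fun_sum (I := Finset.univ)
  have hL : ∀ k, MemLp (ξ (κ k)) 2 P := fun k => (hξ.hasGaussianLaw_eval _).memLp_two
  have hm : ∫ ω, ∑ k, t k * ξ (κ k) ω ∂P = 0 := by
    rw [integral_finsetSum _ fun k _ => ((hL k).integrable (by norm_num)).const_mul _]
    simp [integral_const_mul, hmean]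
  have hv : Var[fun ω => ∑ k, t k * ξ (κ k) ω; P] =
      ∑ k, ∑ l, t k * t l * cov[ξ (κ k), ξ (κ l); P] := by
    rw [← covariance_self hG.aemeasurable, covariance_fun_sum_fun_sum
      (fun k => (hL k).const_mul _) (fun k => (hL k).const_mul _)]
    refine Finset.sum_congr rfl fun k _ => Finset.sum_congr rfl fun l _ => ?_
    rw [covariance_const_mul_left, covariance_const_mul_right, mul_assoc]
  have h := charFun_gaussianReal (μ := 0) (v := Var[fun ω => ∑ k, t k * ξ (κ k) ω; P].toNNReal) 1
  have hmap := hG.map_eq_gaussianReal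
  rw [hm] at hmap
  rw [← hmap, charFun_apply_real, integral_map hG.aemeasurable (by fun_prop)] at h
  rw [← hv]
  simp only [Complex.ofReal_one, one_mul, Real.coe_toNNReal _ (variance_nonneg _ _)] at h
  rw [h]
  simp

end Limit

/-! ### Convergence in law from characteristic functions -/

/-- Lévy's continuity theorem, applied along sequences since the filter is countably generated. The
Euclidean structure supplies the inner product in the characteristic function. -/
lemma tendstoInDistribution_of_charFun {ι K Ω' : Type*} [Fintype K] {Ω : ι → Type*}
    [∀ i, MeasurableSpace (Ω i)] {P : ∀ i, Measure (Ω i)} [∀ i, IsProbabilityMeasure (P i)]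
    [MeasurableSpace Ω'] {P' : Measure Ω'} [IsProbabilityMeasure P'] {l : Filter ι}
    [l.IsCountablyGenerated] {Y : ∀ i, K → Ω i → ℝ} {Z : K → Ω' → ℝ}
    (hY : ∀ i k, AEMeasurable (Y i k) (P i)) (hZ : ∀ k, AEMeasurable (Z k) P')
    (h : ∀ t : K → ℝ, Tendsto
      (fun i => ∫ ω, Complex.exp ((∑ k, t k * Y i k ω : ℝ) * Complex.I) ∂(P i)) l
      (𝓝 (∫ ω, Complex.exp ((∑ k, t k * Z k ω : ℝ) * Complex.I) ∂P'))) :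
    TendstoInDistribution (fun i ω => (WithLp.toLp 2 fun k => Y i k ω : EuclideanSpace ℝ K)) l
      (fun ω => WithLp.toLp 2 fun k => Z k ω) P P' := by
  have hlp : Measurable (WithLp.toLp 2 : (K → ℝ) → EuclideanSpace ℝ K) := by fun_prop
  have hYm : ∀ i, AEMeasurable (fun ω => (WithLp.toLp 2 fun k => Y i k ω : EuclideanSpace ℝ K))
      (P i) := fun i => hlp.comp_aemeasurable (aemeasurable_pi_lambda _ (hY i))
  have hZm : AEMeasurable (fun ω => (WithLp.toLp 2 fun k => Z k ω : EuclideanSpace ℝ K)) P' :=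
    hlp.comp_aemeasurable (aemeasurable_pi_lambda _ hZ)
  refine ⟨hYm, hZm, tendsto_of_seq_tendsto fun x hx => ?_⟩
  refine ProbabilityMeasure.tendsto_of_tendsto_charFun fun t => ?_
  have e : ∀ y : K → ℝ, ((inner ℝ (WithLp.toLp 2 y : EuclideanSpace ℝ K) t : ℝ) : ℂ) =
      ((∑ k, t k * y k : ℝ) : ℂ) := fun y => by
    congr 1
  have e1 : ∀ i, charFun ((P i).map fun ω => (WithLp.toLp 2 fun k => Y i k ω : EuclideanSpace ℝ K))
      t = ∫ ω, Complex.exp ((∑ k, t k * Y i k ω : ℝ) * Complex.I) ∂(P i) := fun i => by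
    rw [charFun_apply, integral_map (hYm i) (by fun_prop)]
    simp only [e]
  have e2 : charFun (P'.map fun ω => (WithLp.toLp 2 fun k => Z k ω : EuclideanSpace ℝ K))
      t = ∫ ω, Complex.exp ((∑ k, t k * Z k ω : ℝ) * Complex.I) ∂P' := by
    rw [charFun_apply, integral_map hZm (by fun_prop)]
    simp only [e]
  have := (h t).comp hx
  rw [← e2] at this
  exact this.congr fun n => (e1 _).symm

instance : Scale.toZero.IsCountablyGenerated := by
  unfold Scale.toZero; infer_instance

lemma Scale.tendsto_val : Tendsto (fun ε : Scale => (ε : ℝ)) Scale.toZero (𝓝[>] 0) :=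
  tendsto_nhdsWithin_iff.2 ⟨tendsto_comap, Eventually.of_forall fun ε => ε.2⟩

end Multitime

theorem theorem3
    (ρ : ℝ → ℝ) (hρ_nonneg : ∀ x, 0 ≤ ρ x) (hρ : LocallyIntegrable ρ)
    (κ : Kernel ℝ (ℝ × ℝ)) [IsMarkovKernel κ]
    (μ : Measure Multitime.Marked) (hμ : μ = Multitime.ofDensity ρ κ)
    (hM : Multitime.InM μ)
    (Λ : ℝ → Kernel ℝ (ℝ × ℝ)) (hΛ : Multitime.IsLocalDensity μ Λ)
    (z s : ℝ) (hreg : Multitime.RegularAt Λ z s)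
    (Ω : Multitime.Scale → Type*) [∀ ε, MeasurableSpace (Ω ε)]
    (P : ∀ ε, Measure (Ω ε)) [∀ ε, IsProbabilityMeasure (P ε)]
    (X : ∀ ε, Ω ε → Set Multitime.Marked)
    (hX : ∀ ε : Multitime.Scale,
      Multitime.IsPoissonProcess (P ε) (X ε) (ENNReal.ofReal (ε : ℝ)⁻¹ • μ)) :
    ∃ (Ω' : Type) (_ : MeasurableSpace Ω') (P' : Measure Ω') (_ : IsProbabilityMeasure P')
      (ηhat ηtilde : Multitime.Plane → Ω' → ℝ),
      Multitime.IsLevyChentsov P' ηhat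
        (Multitime.crossDist (Multitime.hatMeasure Λ z s)) ∧
      Multitime.IsLevyChentsov P' ηtilde
        (Multitime.crossDist (Multitime.tildeMeasure Λ z s)) ∧
      IndepFun (fun ω a => ηhat a ω) (fun ω a => ηtilde a ω) P' ∧
      ∀ I J : Finset Multitime.Plane,
        TendstoInDistribution
          (fun (ε : Multitime.Scale) (ω : Ω ε.sq) =>
            ((fun a : I => Multitime.microField μ z s ε (X ε.sq ω) a,
              fun b : J => Multitime.macroField μ z s ε (X ε.sq ω) b) :
              (I → ℝ) × (J → ℝ)))
          Multitime.Scale.toZero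
          (fun ω => (fun a : I => ηhat a ω, fun b : J => ηtilde b ω))
          (fun ε => P ε.sq) P' := by
  open Multitime in
  have hsf : SFinite μ := by rw [hμ, ofDensity]; infer_instance
  have hcr := hΛ.isCrossRegular hM
  have hhat := hreg.isCrossRegular_hatMeasure hΛ
  have htilde := hΛ.isCrossRegular_tildeMeasure hM z s
  obtain ⟨Ω', _, P', _, ξ, hξm, hξ, hmean, hcov⟩ :=
    exists_isGaussianProcess (jumpVector hhat htilde)
  have hcov' : ∀ k l, cov[ξ k, ξ l; P'] = limitCov Λ z s k l := by
    intro k l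
    rw [hcov, WithLp.prod_inner_apply]
    rcases k with a | a <;> rcases l with b | b
    · simpa [jumpVector, limitCov] using hhat.inner_toLp_jump a b
    · simp [jumpVector, limitCov]
    · simp [jumpVector, limitCov]
    · simpa [jumpVector, limitCov] using htilde.inner_toLp_jump a b
  refine ⟨Ω', inferInstance, P', inferInstance, fun a => ξ (.inl a), fun b => ξ (.inr b),
    isLevyChentsov_of_covariance (hξ.comp_right Sum.inl) (fun a => hmean _) (fun a b => hcov' _ _),
    isLevyChentsov_of_covariance (hξ.comp_right Sum.inr) (fun a => hmean _) (fun a b => hcov' _ _),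
    ?_, fun I J => ?_⟩
  · refine IsGaussianProcess.indepFun_of_covariance_eq_zero (X := fun a => ξ (.inl a))
      (Y := fun b => ξ (.inr b)) ?_ (fun a => (hξm _).aemeasurable)
      (fun b => (hξm _).aemeasurable) (fun a b => hcov' _ _)
    have : (Sum.elim (fun a => ξ (.inl a)) fun b => ξ (.inr b)) = ξ := Sum.elim_comp_inl_inr ξ
    rwa [this]
  · let k : I ⊕ J → Plane ⊕ Plane := Sum.map Subtype.val Subtype.val
    have hX' : ∀ ε : Scale, IsPoissonProcess (P ε.sq) (X ε.sq) (intensity μ ε) := fun ε => hX ε.sq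
    have key : TendstoInDistribution
        (fun (ε : Scale) (ω : Ω ε.sq) => (WithLp.toLp 2 fun i =>
          fluctuation μ z s ε (X ε.sq ω) (k i) : EuclideanSpace ℝ (I ⊕ J)))
        Scale.toZero (fun ω => WithLp.toLp 2 fun i => ξ (k i) ω) (fun ε => P ε.sq) P' := by
      refine tendstoInDistribution_of_charFun
        (fun ε i => ((hX' ε).measurable_fluctuation _).aemeasurable)
        (fun i => (hξm _).aemeasurable) fun t => ?_
      rw [charFun_gaussianProcess hξ hmean]
      simp_rw [hcov', fun ε : Scale => (hX' ε).charFun_fluctuation (z := z) (s := s) ε.2 hcr hM k t]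
      exact (Complex.continuous_exp.tendsto _).comp
        ((hreg.tendsto_exponent hΛ hM k t).comp Scale.tendsto_val)
    -- Splitting the joint vector into its two blocks is continuous, so convergence in law is
    -- preserved.
    exact key.continuous_comp (g := fun x : EuclideanSpace ℝ (I ⊕ J) =>
      ((fun a : I => x (.inl a), fun b : J => x (.inr b)) : (I → ℝ) × (J → ℝ))) (by fun_prop)
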